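/- Let $P\subset\mathbb R^n$ be a nonempty rational polytope (the convex hull of finitely many points of $\mathbb Q^n$) of dimension $d$. All faces are nonempty, a facet of a face $F$ is a face of $F$ of dimension $\dim F-1$, and a simplex is the convex hull of affinely independent points. For a rational polytope $X$ with direction space $V$ (the linear subspace parallel to $\operatorname{aff}(X)$), $\mathrm{Vol}(X)$ denotes the lattice normalized volume: the Lebesgue measure on $\operatorname{aff}(X)$ scaled such that $\operatorname{conv}(w,w+b_1,\dots,w+b_r)$, $w\in\operatorname{aff}(X)$, has measure $1$ for a $\mathbb Z$-basis $b_1,\dots,b_r$ of $V\cap\mathbb Z^n$. For a rational polytope $G$ and a rational point $x\notin\operatorname{aff}(G)$, the lattice height is $\mathrm{Ht}_G(x)=|\lambda(x)-\beta|$, where $\lambda$ is a linear form on $\mathbb{R}^n$ that maps $V_0\cap\mathbb Z^n$ onto $\mathbb Z$, $V_0$ being the direction space of $A=\operatorname{aff}(G\cup\{x\})$, and $\operatorname{aff}(G)=\{y\in A:\lambda(y)=\beta\}$; for $x\in\operatorname{aff}(G)$ one sets $\mathrm{Ht}_G(x)=0$. A descent system $\mathcal D$ for $P$ consists of finite sets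 $\mathcal D_0=\{P\},\mathcal D_1,\mathcal D_2,\dots$ of faces of $P$ and of a choice of a vertex $v(F)$ of $F$ for every nonsimplex $F\in\bigcup_i\mathcal D_i$, such that for all $i$: (1) every $F\in\mathcal D_i$ has dimension $d-i$; (2) if $F\in\mathcal D_i$ is not a simplex and $G$ is a facet of $F$ with $v(F)\notin G$, then $G\in\mathcal D_{i+1}$; (3) every $G\in\mathcal D_{i+1}$ is a facet, not containing $v(F)$, of some nonsimplex $F\in\mathcal D_i$. For $F\in\mathcal D_k$ let $$w(F)=\sum_{(F_0,\dots,F_k)}\ \prod_{i=0}^{k-1}\mathrm{Ht}_{F_{i+1}}(v(F_i)),$$ where the sum is over all flags $(F_0,\dots,F_k)$ with $F_i\in\mathcal D_i$ for all $i$, $F_k=F$, and, for $i<k$, $F_i$ not a simplex and $F_{i+1}$ a facet of $F_i$ with $v(F_i)\notin F_{i+1}$. The descent algorithm starts with the current layer $\{P\}$, the weight $1$ for $P$, an empty next layer and the total $0$. It processes the faces $F$ of the current layer, in any order. If $F$ is a simplex, then $w(F)\mathrm{Vol}(F)$ is added to the total. Otherwise a vertex $v$ of $F$ is selected, and for each facet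 $G$ of $F$ with $v\notin G$, in any order, $G$ is inserted into the next layer with weight $0$ if it has not been found before, and then its weight is increased by $w(F)\mathrm{Ht}_G(v)$. When the current layer has been processed completely, the next layer becomes the current one and is replaced by the empty set; the algorithm stops when both layers are empty. Proposition (correctness of the descent algorithm). (a) For every descent system $\mathcal D$ for $P$ with weights $w$, $$\mathrm{Vol}(P)=\sum_{\substack{F\in\bigcup_i\mathcal D_i\\ F\text{ simplex}}} w(F)\,\mathrm{Vol}(F).$$ (b) If the algorithm selects the vertices $v=v(F)$ of a descent system $\mathcal D$, then every run terminates with the total $\mathrm{Vol}(P)$, and the weight it has accumulated for each $F\in\bigcup_i\mathcal D_i$ is $w(F)$. (c) For an arbitrary selection of a vertex in each processed nonsimplex face, every run of the algorithm terminates with the total $\mathrm{Vol}(P)$. -/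

import Mathlib

open Set MeasureTheory

noncomputable section

namespace Descent

/-- A rational polytope in `ℝⁿ`: the convex hull of finitely many, at least one, rational points. -/
def IsRationalPolytope {n : ℕ} (P : Set (Fin n → ℝ)) : Prop :=
  ∃ S : Finset (Fin n → ℚ), S.Nonempty ∧
    P = convexHull ℝ ((fun (q : Fin n → ℚ) (i : Fin n) => (q i : ℝ)) '' (S : Set (Fin n → ℚ)))

/-- The dimension of (the affine hull of) `X`. -/
def dim {n : ℕ} (X : Set (Fin n → ℝ)) : ℕ :=
  Module.finrank ℝ (vectorSpan ℝ X)

/-- `F` is a nonempty face of the polytope `P`: the set of maximizers on `P` of some linear form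
(the zero form gives `P` itself). -/
def IsFace {n : ℕ} (F P : Set (Fin n → ℝ)) : Prop :=
  F.Nonempty ∧ IsExposed ℝ P F

/-- `G` is a facet of `F`: a face of codimension one. -/
def IsFacet {n : ℕ} (G F : Set (Fin n → ℝ)) : Prop :=
  IsFace G F ∧ dim G + 1 = dim F

/-- `F` is a simplex: the convex hull of affinely independent points. -/
def IsSimplex {n : ℕ} (F : Set (Fin n → ℝ)) : Prop :=
  ∃ (k : ℕ) (T : Affine.Simplex ℝ (Fin n → ℝ) k), F = convexHull ℝ (Set.range T.points)

/-! ### Lattice volume and lattice height -/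

/-- The lattice `A₀ ∩ ℤⁿ`, where `A₀` is the linear subspace parallel to the affine hull of `X`. -/
def directionLattice {n : ℕ} (X : Set (Fin n → ℝ)) : Submodule ℤ (Fin n → ℝ) :=
  (vectorSpan ℝ X).restrictScalars ℤ ⊓ Submodule.span ℤ (Set.range (Pi.basisFun ℝ (Fin n)))

/-- The affine parametrization `t ↦ w + ∑ tᵢ bᵢ`. -/
def affineChart {n d : ℕ} (w : Fin n → ℝ) (b : Fin d → Fin n → ℝ) (t : Fin d → ℝ) : Fin n → ℝ :=
  w + ∑ i, t i • b i

/-- The `d`-dimensional measure of `X` in the affine space `w + ℝ b₁ + ⋯ + ℝ b_d`, scaled such that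
the simplex with vertices `w, w + b₁, …, w + b_d` has measure one. -/
def scaledVolume {n d : ℕ} (w : Fin n → ℝ) (b : Fin d → Fin n → ℝ) (X : Set (Fin n → ℝ)) : ℝ :=
  volume.real (affineChart w b ⁻¹' X) /
    volume.real (affineChart w b ⁻¹' convexHull ℝ (insert w (Set.range fun i => w + b i)))

open Classical in
/-- The lattice (normalized) volume of `X`: the Lebesgue measure on the affine hull of `X`, scaled
such that `conv(w, w + b₁, …, w + b_d)` has measure one for a `ℤ`-basis `b₁, …, b_d` of the
direction lattice. Such a basis, with `d = dim X`, exists whenever the affine hull is rational;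
the value is independent of the choice of the basis and of the base point `w ∈ X`. -/
def latticeVolume {n : ℕ} (X : Set (Fin n → ℝ)) : ℝ :=
  if h : X.Nonempty ∧ Nonempty (Module.Basis (Fin (dim X)) ℤ (directionLattice X)) then
    scaledVolume h.1.some (fun i => (h.2.some i : Fin n → ℝ)) X
  else 0

/-- `r` is the value `|λ(x) - β|`, where `λ` is a linear form that is integral and primitive on the
direction lattice of `A = aff(x, G)`, and `aff(G)` is given in `A` by the equation `λ(y) = β`. -/
def IsHeightValue {n : ℕ} (G : Set (Fin n → ℝ)) (x : Fin n → ℝ) (r : ℝ) : Prop :=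
  ∃ (l : (Fin n → ℝ) →ₗ[ℝ] ℝ) (β : ℝ),
    (∀ z ∈ directionLattice (insert x G), ∃ m : ℤ, l z = m) ∧
    (∃ z ∈ directionLattice (insert x G), l z = 1) ∧
    (∀ y ∈ affineSpan ℝ (insert x G), y ∈ affineSpan ℝ G ↔ l y = β) ∧
    r = |l x - β|

open Classical in
/-- The lattice height of `x` over `aff(G)`. -/
def latticeHeight {n : ℕ} (G : Set (Fin n → ℝ)) (x : Fin n → ℝ) : ℝ :=
  if x ∈ affineSpan ℝ G then 0
  else if h : ∃ r, IsHeightValue G x r then h.choose else 0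

/-! ### Descent systems, flags and weights -/

/-- A descent system for `P`. The layers are indexed by all natural numbers; the dimension
condition, together with `exists_of_mem_layer`, forces the layers beyond index `dim P - 1` to be
empty (if `dim P ≥ 1`). The values of `apex` matter only on nonsimplex members of the layers. -/
structure DescentSystem {n : ℕ} (P : Set (Fin n → ℝ)) where
  layer : ℕ → Finset (Set (Fin n → ℝ))
  apex : Set (Fin n → ℝ) → (Fin n → ℝ)
  layer_zero : layer 0 = {P}
  apex_mem : ∀ i, ∀ F ∈ layer i, ¬ IsSimplex F → apex F ∈ F.extremePoints ℝ
  face_of_mem_layer : ∀ i, ∀ F ∈ layer i, IsFace F P ∧ dim F + i = dim P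
  facet_mem_layer : ∀ i, ∀ F ∈ layer i, ¬ IsSimplex F →
    ∀ G, IsFacet G F → apex F ∉ G → G ∈ layer (i + 1)
  exists_of_mem_layer : ∀ i, ∀ G ∈ layer (i + 1),
    ∃ F ∈ layer i, ¬ IsSimplex F ∧ IsFacet G F ∧ apex F ∉ G

/-- `(f 0, …, f k)` is a flag in the descent system: `f i` lies in the `i`-th layer, and each
`f (i + 1)` is a facet of the nonsimplex face `f i` that does not contain the chosen vertex of
`f i`. -/
def DescentSystem.IsFlag {n : ℕ} {P : Set (Fin n → ℝ)} (D : DescentSystem P) {k : ℕ}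
    (f : Fin (k + 1) → Set (Fin n → ℝ)) : Prop :=
  (∀ i : Fin (k + 1), f i ∈ D.layer i) ∧
  ∀ i : Fin k, ¬ IsSimplex (f i.castSucc) ∧ IsFacet (f i.succ) (f i.castSucc) ∧
    D.apex (f i.castSucc) ∉ f i.succ

open Classical in
/-- The weight of `F ∈ layer k`: the sum over all flags `(F₀, …, F_k = F)` of the products of the
lattice heights of the chosen vertex of `Fᵢ` over `Fᵢ₊₁`, `i = 0, …, k - 1`. -/
def DescentSystem.weight {n : ℕ} {P : Set (Fin n → ℝ)} (D : DescentSystem P) (k : ℕ)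
    (F : Set (Fin n → ℝ)) : ℝ :=
  ∑ f ∈ Fintype.piFinset (fun i : Fin (k + 1) => D.layer i) with D.IsFlag f ∧ f (Fin.last k) = F,
    ∏ i : Fin k, latticeHeight (f i.succ) (D.apex (f i.castSucc))

/-! ### The descent algorithm -/

/-- A state of the descent algorithm: the faces of the current layer that still have to be
processed, the faces of the next layer found so far, the weights, and the accumulated total. -/
structure State (n : ℕ) where
  current : Finset (Set (Fin n → ℝ))
  next : Finset (Set (Fin n → ℝ))
  weight : Set (Fin n → ℝ) → ℝ
  total : ℝ

open Classical in
/-- At the start the current layer is `{P}`, the weight of `P` is `1` and the total is `0`. -/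
def State.init {n : ℕ} (P : Set (Fin n → ℝ)) : State n where
  current := {P}
  next := ∅
  weight := fun F => if F = P then 1 else 0
  total := 0

/-- The computation is complete when the current and the next layer are empty. -/
def State.Finished {n : ℕ} (s : State n) : Prop :=
  s.current = ∅ ∧ s.next = ∅

open Classical in
/-- Remove `F` from the faces still to be processed. -/
def State.remove {n : ℕ} (s : State n) (F : Set (Fin n → ℝ)) : State n :=
  { s with current := s.current.erase F }

/-- Add `c` to the accumulated total. -/
def State.addTotal {n : ℕ} (s : State n) (c : ℝ) : State n :=
  { s with total := s.total + c }

open Classical in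
/-- Insert `G` with weight `0` into the next layer if it has not been found before. -/
def State.insertNext {n : ℕ} (s : State n) (G : Set (Fin n → ℝ)) : State n :=
  if G ∈ s.next then s
  else { s with next := insert G s.next, weight := Function.update s.weight G 0 }

open Classical in
/-- The treatment of a facet `G` of `F` that does not contain the selected vertex `v`: insert `G`
into the next layer and increase its weight by `w(F)` times the height of `v` over `G`. -/
def State.pushFacet {n : ℕ} (F : Set (Fin n → ℝ)) (v : Fin n → ℝ) (s : State n)
    (G : Set (Fin n → ℝ)) : State n :=
  let t := s.insertNext G
  let c := t.weight G + t.weight F * latticeHeight G v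
  { t with weight := Function.update t.weight G c }

/-- One step of the descent algorithm, where `sel F v` says that `v` may be selected as the
distinguished vertex of `F`. The faces of a layer, and the facets of a face, may be processed in
any order. -/
inductive Step {n : ℕ} (sel : Set (Fin n → ℝ) → (Fin n → ℝ) → Prop) : State n → State n → Prop
  | simplex (s : State n) (F : Set (Fin n → ℝ)) (hF : F ∈ s.current) (hs : IsSimplex F) :
      Step sel s ((s.remove F).addTotal (s.weight F * latticeVolume F))
  | descend (s : State n) (F : Set (Fin n → ℝ)) (hF : F ∈ s.current) (hs : ¬ IsSimplex F)
      (v : Fin n → ℝ) (hv : sel F v) (facets : List (Set (Fin n → ℝ))) (hnodup : facets.Nodup)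
      (hfacets : ∀ G, G ∈ facets ↔ IsFacet G F ∧ v ∉ G) :
      Step sel s (facets.foldl (State.pushFacet F v) (s.remove F))
  | nextLayer (s : State n) (hc : s.current = ∅) (hn : s.next ≠ ∅) :
      Step sel s { s with current := s.next, next := ∅ }

/-- `s` occurs in a run of the descent algorithm on input `P`. -/
def Reachable {n : ℕ} (sel : Set (Fin n → ℝ) → (Fin n → ℝ) → Prop) (P : Set (Fin n → ℝ))
    (s : State n) : Prop :=
  Relation.ReflTransGen (Step sel) (State.init P) s

/-- The descent algorithm on input `P` computes the number `c`: there is no infinite run, a run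
never gets stuck before it is finished, and every finished run has accumulated the total `c`. -/
def Computes {n : ℕ} (sel : Set (Fin n → ℝ) → (Fin n → ℝ) → Prop) (P : Set (Fin n → ℝ))
    (c : ℝ) : Prop :=
  (¬ ∃ run : ℕ → State n, run 0 = State.init P ∧ ∀ k, Step sel (run k) (run (k + 1))) ∧
  (∀ s, Reachable sel P s → ¬ s.Finished → ∃ t, Step sel s t) ∧
  (∀ s, Reachable sel P s → s.Finished → s.total = c)

end Descent

end

open scoped Pointwise

namespace Descent

variable {n : ℕ}

/-! Everything rests on one identity, `latticeVolume_eq_sum_facets`: for a point `v` of a rational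
polytope `F` of positive dimension, Vol(F) is the sum of Ht_G(v) Vol(G) over the facets `G` of `F`
that miss `v`.

The pyramids conv(v, G) cover `F` up to a null set. The ray from `v` through an interior point
leaves `F` in a proper face (`exists_face_of_mem_interior`), and a pyramid over a proper face is
null unless that face is a facet missing `v`. Two of the remaining pyramids overlap only inside a
hyperplane (`volume_inter_pyramids`). For a single pyramid, the direction lattice of `G` is
saturated in that of `F`, so a ℤ-basis of the former extends by one vector to a ℤ-basis of the
latter (`exists_adapted_basis`). In these coordinates the base lies in a coordinate hyperplane and
the lattice height is the absolute value of the extra coordinate. Cavalieri's principle produces a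
factor 1/(d+1), which cancels against the same factor in the volume of the normalizing simplex
(`pyramid_latticeVolume`).

For a descent system, the flag weights satisfy a one-step recursion (`DescentSystem.weight_succ`).
Hence applying the identity to all nonsimplices of a layer moves their weighted volume to the next
layer, and the sum telescopes until the layers run out for dimension reasons.

For the algorithm, the same identity makes `State.value` invariant under every step
(`IsDescentClass.step`). It is Vol(P) at the start and equals the total at the end. Termination is
lexicographic in the dimension of the current layer and the number of its unprocessed faces.
`IsDescentClass` isolates what this argument needs, so that prescribed and arbitrary selections are
covered together. That the accumulated weights are the flag weights is a second invariant,
`DescentSystem.IsProcessing`. -/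

/-! ### Rational polytopes and their faces -/

lemma exists_polytope_generators {P : Set (Fin n → ℝ)} (hP : IsRationalPolytope P) :
    ∃ S : Set (Fin n → ℝ), S.Finite ∧ S.Nonempty ∧ P = convexHull ℝ S ∧
      ∀ s ∈ S, ∃ q : Fin n → ℚ, s = fun i => (q i : ℝ) := by
  obtain ⟨S, hS, rfl⟩ := hP
  refine ⟨_, S.finite_toSet.image _, (Finset.coe_nonempty.2 hS).image _, rfl, ?_⟩
  rintro _ ⟨q, -, rfl⟩
  exact ⟨q, rfl⟩

lemma isRationalPolytope_convexHull {S : Set (Fin n → ℝ)} (hfin : S.Finite) (hne : S.Nonempty)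
    (hq : ∀ s ∈ S, ∃ q : Fin n → ℚ, s = fun i => (q i : ℝ)) :
    IsRationalPolytope (convexHull ℝ S) := by
  have hsub : S ⊆ (fun (q : Fin n → ℚ) (i : Fin n) => (q i : ℝ)) '' Set.univ := by
    intro s hs
    obtain ⟨q, hq⟩ := hq s hs
    exact ⟨q, Set.mem_univ q, hq.symm⟩
  obtain ⟨T, -, hT, rfl⟩ := Set.exists_subset_image_finite_and.1 ⟨S, hsub, hfin, rfl⟩
  lift T to Finset (Fin n → ℚ) using hT
  exact ⟨T, Finset.coe_nonempty.1 hne.of_image, rfl⟩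

lemma IsRationalPolytope.isCompact {P : Set (Fin n → ℝ)} (hP : IsRationalPolytope P) :
    IsCompact P := by
  obtain ⟨S, hfin, -, rfl, -⟩ := exists_polytope_generators hP
  exact hfin.isCompact_convexHull (𝕜 := ℝ)

lemma IsRationalPolytope.convex {P : Set (Fin n → ℝ)} (hP : IsRationalPolytope P) :
    Convex ℝ P := by
  obtain ⟨S, -, rfl⟩ := hP
  exact convex_convexHull ℝ _

lemma IsRationalPolytope.nonempty {P : Set (Fin n → ℝ)} (hP : IsRationalPolytope P) :
    P.Nonempty := by
  obtain ⟨S, -, hne, rfl, -⟩ := exists_polytope_generators hP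
  exact hne.convexHull

/-- An exposed face of a polytope is the convex hull of the generators that it contains. -/
lemma IsFace.eq_convexHull {S F : Set (Fin n → ℝ)} (hS : S.Finite)
    (hF : IsFace F (convexHull ℝ S)) : F = convexHull ℝ (S ∩ F) := by
  have hconv : Convex ℝ F := hF.2.convex (convex_convexHull ℝ S)
  have hcomp : IsCompact F := hF.2.isCompact (hS.isCompact_convexHull (𝕜 := ℝ))
  refine Subset.antisymm ?_ (convexHull_min inter_subset_right hconv)
  -- Extreme points of an exposed face are extreme in the whole polytope, hence generators;
  -- Krein–Milman then recovers `F` from them.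
  have hext : F.extremePoints ℝ ⊆ S ∩ F := fun x hx =>
    ⟨extremePoints_convexHull_subset (hF.2.isExtreme.extremePoints_subset_extremePoints hx),
      extremePoints_subset hx⟩
  have hclosed : IsClosed (convexHull ℝ (S ∩ F)) :=
    ((hS.subset inter_subset_left).isCompact_convexHull (𝕜 := ℝ)).isClosed
  calc F = closure (convexHull ℝ (F.extremePoints ℝ)) :=
        (closure_convexHull_extremePoints hcomp hconv).symm
    _ ⊆ convexHull ℝ (S ∩ F) := closure_minimal (convexHull_mono hext) hclosed

lemma IsRationalPolytope.face {P F : Set (Fin n → ℝ)} (hP : IsRationalPolytope P)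
    (hF : IsFace F P) : IsRationalPolytope F := by
  obtain ⟨S, hfin, -, rfl, hq⟩ := exists_polytope_generators hP
  have h := hF.eq_convexHull hfin
  rw [h]
  refine isRationalPolytope_convexHull (hfin.subset inter_subset_left) ?_ fun s hs => hq s hs.1
  rw [← convexHull_nonempty_iff (𝕜 := ℝ), ← h]
  exact hF.1

/-- A face is determined by the generators it contains, and these form one of finitely many subsets.
-/
lemma IsRationalPolytope.finite_faces {P : Set (Fin n → ℝ)} (hP : IsRationalPolytope P) :
    {F | IsFace F P}.Finite := by
  obtain ⟨S, hfin, -, rfl, -⟩ := exists_polytope_generators hP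
  refine (hfin.finite_subsets.image (convexHull ℝ)).subset fun F hF => ?_
  exact ⟨S ∩ F, inter_subset_left, (hF.eq_convexHull hfin).symm⟩

lemma IsRationalPolytope.finite_facets {P : Set (Fin n → ℝ)} (hP : IsRationalPolytope P) :
    {F | IsFacet F P}.Finite :=
  hP.finite_faces.subset fun _ hF => hF.1

/-- Ensures that the descent never splits a zero-dimensional face, for which the facet sum would be
empty. -/
lemma isSimplex_of_dim_eq_zero {P : Set (Fin n → ℝ)} (hP : IsRationalPolytope P)
    (h0 : dim P = 0) : IsSimplex P := by
  obtain ⟨x, hx⟩ := hP.nonempty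
  have hbot : vectorSpan ℝ P = ⊥ := Submodule.finrank_eq_zero.1 h0
  have hsub : P.Subsingleton := (vectorSpan_eq_bot_iff_subsingleton ℝ).1 hbot
  have hPx : P = {x} := hsub.eq_singleton_of_mem hx
  exact ⟨0, Affine.Simplex.mkOfPoint ℝ x, by simp [hPx]⟩

lemma dim_pos_of_not_isSimplex {P : Set (Fin n → ℝ)} (hP : IsRationalPolytope P)
    (h : ¬ IsSimplex P) : 0 < dim P :=
  Nat.pos_of_ne_zero fun h0 => h (isSimplex_of_dim_eq_zero hP h0)

/-! ### Lattices -/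

/-- This is where rationality enters: a difference of two rational generators becomes a lattice
vector once denominators are cleared. -/
lemma IsRationalPolytope.span_directionLattice {P : Set (Fin n → ℝ)}
    (hP : IsRationalPolytope P) :
    Submodule.span ℝ (directionLattice P : Set (Fin n → ℝ)) = vectorSpan ℝ P := by
  refine le_antisymm (Submodule.span_le.2 fun z hz => hz.1) ?_
  obtain ⟨S, -, ⟨s₀, hs₀⟩, rfl, hq⟩ := exists_polytope_generators hP
  have hV : vectorSpan ℝ (convexHull ℝ S) = vectorSpan ℝ S := by
    rw [← direction_affineSpan, affineSpan_convexHull, direction_affineSpan]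
  rw [hV, vectorSpan_eq_span_vsub_set_right ℝ hs₀, Submodule.span_le]
  rintro _ ⟨s, hs, rfl⟩
  obtain ⟨q, rfl⟩ := hq s hs
  obtain ⟨q₀, rfl⟩ := hq s₀ hs₀
  -- `N` is a common denominator of the coordinates of `q - q₀`.
  obtain ⟨N, hN⟩ := IsLocalization.exist_integer_multiples_of_finset (nonZeroDivisors ℤ)
    (Finset.univ.image fun i => q i - q₀ i)
  have hN0 : ((N : ℤ) : ℝ) ≠ 0 := by
    exact_mod_cast nonZeroDivisors.coe_ne_zero N
  set z : Fin n → ℝ := ((N : ℤ) : ℝ) • ((fun i => (q i : ℝ)) - fun i => (q₀ i : ℝ)) with hz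
  have hzmem : z ∈ directionLattice (convexHull ℝ S) := by
    refine ⟨?_, ?_⟩
    · simp only [Submodule.coe_restrictScalars, SetLike.mem_coe, hV]
      exact Submodule.smul_mem _ _ (vsub_mem_vectorSpan ℝ hs hs₀)
    · simp only [SetLike.mem_coe]
      rw [Module.Basis.mem_span_iff_repr_mem]
      intro i
      obtain ⟨m, hm⟩ := hN (q i - q₀ i) (Finset.mem_image_of_mem _ (Finset.mem_univ i))
      refine ⟨m, ?_⟩
      have hm' : (m : ℚ) = N * (q i - q₀ i) := by simpa using hm
      simp only [hz, Pi.basisFun_repr, Pi.smul_apply, Pi.sub_apply, smul_eq_mul,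
        algebraMap_int_eq, eq_intCast]
      exact_mod_cast congrArg (fun x : ℚ => (x : ℝ)) hm'
  have : (fun i => (q i : ℝ)) -ᵥ (fun i => (q₀ i : ℝ)) = ((N : ℤ) : ℝ)⁻¹ • z := by
    rw [hz, smul_smul, inv_mul_cancel₀ hN0, one_smul, vsub_eq_sub]
  simp only [SetLike.mem_coe]
  rw [this]
  exact Submodule.smul_mem _ _ (Submodule.subset_span hzmem)

lemma directionLattice_le_integer (X : Set (Fin n → ℝ)) :
    directionLattice X ≤ Submodule.span ℤ (Set.range (Pi.basisFun ℝ (Fin n))) :=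
  inf_le_right

instance discreteTopology_directionLattice (X : Set (Fin n → ℝ)) :
    DiscreteTopology (directionLattice X) :=
  DiscreteTopology.of_subset (inferInstanceAs (DiscreteTopology
    (Submodule.span ℤ (Set.range (Pi.basisFun ℝ (Fin n)))))) (directionLattice_le_integer X)

instance free_directionLattice (X : Set (Fin n → ℝ)) :
    Module.Free ℤ (directionLattice X) :=
  Module.free_of_finite_type_torsion_free'

lemma IsRationalPolytope.finrank_directionLattice {P : Set (Fin n → ℝ)}
    (hP : IsRationalPolytope P) : Module.finrank ℤ (directionLattice P) = dim P := by
  have h := Real.finrank_eq_int_finrank_of_discrete (s := (directionLattice P : Set (Fin n → ℝ)))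
    (by rw [Submodule.span_eq]; infer_instance)
  rw [Set.finrank, Set.finrank, hP.span_directionLattice, Submodule.span_eq] at h
  exact h.symm

lemma IsRationalPolytope.nonempty_basis {P : Set (Fin n → ℝ)}
    (hP : IsRationalPolytope P) :
    Nonempty (Module.Basis (Fin (dim P)) ℤ (directionLattice P)) :=
  ⟨Module.finBasisOfFinrankEq _ _ hP.finrank_directionLattice⟩

lemma IsRationalPolytope.span_basis {P : Set (Fin n → ℝ)} (hP : IsRationalPolytope P)
    {ι : Type*} (b : Module.Basis ι ℤ (directionLattice P)) :
    Submodule.span ℝ (Set.range fun i => (b i : Fin n → ℝ)) = vectorSpan ℝ P := by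
  have h : Submodule.span ℤ (Set.range fun i => (b i : Fin n → ℝ)) = directionLattice P := by
    have := congrArg (Submodule.map (directionLattice P).subtype) b.span_eq
    rw [Submodule.map_span, Submodule.map_subtype_top, ← Set.range_comp] at this
    exact this
  have h2 := congrArg (fun L : Submodule ℤ (Fin n → ℝ) => Submodule.span ℝ (L : Set (Fin n → ℝ))) h
  simp only [Submodule.span_span_of_tower] at h2
  rw [h2, hP.span_directionLattice]

lemma IsRationalPolytope.linearIndependent_basis {P : Set (Fin n → ℝ)}
    (hP : IsRationalPolytope P) {d : ℕ} (hd : dim P = d)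
    (b : Module.Basis (Fin d) ℤ (directionLattice P)) :
    LinearIndependent ℝ fun i => (b i : Fin n → ℝ) := by
  rw [linearIndependent_iff_card_eq_finrank_span, Set.finrank, hP.span_basis b, Fintype.card_fin]
  exact hd.symm

/-- A `ℤ`-basis of the direction lattice of a facet extends by one vector to a `ℤ`-basis of the
direction lattice of the polytope. -/
lemma exists_adapted_basis {F G : Set (Fin n → ℝ)} (hF : IsRationalPolytope F)
    (hG : IsRationalPolytope G) (hGF : G ⊆ F) {d : ℕ} (hd : dim G = d) (hdF : dim F = d + 1)
    (b : Module.Basis (Fin d) ℤ (directionLattice G)) :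
    ∃ c : Module.Basis (Fin (d + 1)) ℤ (directionLattice F),
      ∀ i, (c (Fin.succ i) : Fin n → ℝ) = b i := by
  have hle : directionLattice G ≤ directionLattice F :=
    inf_le_inf_right _ (fun x hx => vectorSpan_mono ℝ hGF hx)
  set N := (directionLattice G).comap (directionLattice F).subtype with hN
  -- Saturation: the sublattice is cut out by a real subspace, which is closed under division by
  -- nonzero integers. Hence the quotient is torsion-free, so free of rank one.
  have htf : ∀ (k : ℤ) (x : directionLattice F), k ≠ 0 → k • x ∈ N → x ∈ N := by
    intro k x hk hx
    have hx' : k • (x : Fin n → ℝ) ∈ vectorSpan ℝ G := hx.1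
    refine ⟨?_, x.2.2⟩
    have hk' : (k : ℝ) ≠ 0 := by exact_mod_cast hk
    rw [← Int.cast_smul_eq_zsmul ℝ] at hx'
    exact (Submodule.smul_mem_iff (vectorSpan ℝ G) hk').1 hx'
  have hNT : Module.IsTorsionFree ℤ (directionLattice F ⧸ N) := by
    refine Module.IsTorsionFree.of_smul_eq_zero ?_
    intro k x hkx
    induction x using Submodule.Quotient.induction_on with
    | _ x =>
    rw [← Submodule.Quotient.mk_smul, Submodule.Quotient.mk_eq_zero] at hkx
    by_cases hk : k = 0
    · exact Or.inl hk
    · exact Or.inr ((Submodule.Quotient.mk_eq_zero _).2 (htf k x hk hkx))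
  have hfr : Module.finrank ℤ (directionLattice F ⧸ N) = 1 := by
    have h1 := N.finrank_quotient_add_finrank
    have h2 : Module.finrank ℤ N = d := by
      rw [(Submodule.comapSubtypeEquivOfLe hle).finrank_eq, hG.finrank_directionLattice, hd]
    rw [hF.finrank_directionLattice] at h1
    omega
  have : Module.Free ℤ (directionLattice F ⧸ N) := Module.free_of_finite_type_torsion_free'
  let e : Module.Basis (Fin 1) ℤ (directionLattice F ⧸ N) := Module.finBasisOfFinrankEq _ _ hfr
  -- The extra basis vector is any lift of a generator of the quotient.
  obtain ⟨y, hy⟩ := Submodule.Quotient.mk_surjective N (e 0)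
  have hsp : ∀ z : directionLattice F, ∃ c : ℤ, z + c • y ∈ N := by
    intro z
    refine ⟨-(e.repr (Submodule.Quotient.mk z) 0), ?_⟩
    rw [← Submodule.Quotient.mk_eq_zero, Submodule.Quotient.mk_add, Submodule.Quotient.mk_smul, hy,
      neg_smul]
    have := e.sum_repr (Submodule.Quotient.mk z)
    rw [Fin.sum_univ_one] at this
    rw [this, add_neg_cancel]
  have hli : ∀ (c : ℤ), ∀ x ∈ directionLattice G, c • (y : Fin n → ℝ) + x = 0 → c = 0 := by
    intro c x hx h
    by_contra hc
    have hcy : c • y ∈ N := by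
      have : c • (y : Fin n → ℝ) = -x := eq_neg_of_add_eq_zero_left h
      change c • (y : Fin n → ℝ) ∈ directionLattice G
      rw [this]
      exact neg_mem hx
    have hyN := htf c y hc hcy
    rw [← Submodule.Quotient.mk_eq_zero, hy] at hyN
    exact e.ne_zero 0 hyN
  have hsp' : ∀ z ∈ directionLattice F, ∃ c : ℤ, z + c • (y : Fin n → ℝ) ∈ directionLattice G :=
    fun z hz => hsp ⟨z, hz⟩
  refine ⟨Module.Basis.mkFinConsOfLE (y : Fin n → ℝ) y.2 b hle hli
    hsp', fun i => ?_⟩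
  rw [Module.Basis.coe_mkFinConsOfLE]
  rfl

/-! ### Affine charts -/

lemma affineChart_eq {d : ℕ} (w : Fin n → ℝ) (b : Fin d → Fin n → ℝ) (t : Fin d → ℝ) :
    affineChart w b t = w + Fintype.linearCombination ℝ b t := by
  rw [affineChart, Fintype.linearCombination_apply]

/-- The affine parametrization as an affine map. -/
noncomputable def affineChartMap {d : ℕ} (w : Fin n → ℝ) (b : Fin d → Fin n → ℝ) :
    (Fin d → ℝ) →ᵃ[ℝ] (Fin n → ℝ) :=
  AffineMap.const ℝ (Fin d → ℝ) w + (Fintype.linearCombination ℝ b).toAffineMap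

lemma coe_affineChartMap {d : ℕ} (w : Fin n → ℝ) (b : Fin d → Fin n → ℝ) :
    ⇑(affineChartMap w b) = affineChart w b := by
  ext t : 1
  rw [affineChart_eq]
  rfl

lemma affineChart_injective {d : ℕ} (w : Fin n → ℝ) {b : Fin d → Fin n → ℝ}
    (hb : LinearIndependent ℝ b) : Function.Injective (affineChart w b) := by
  intro s t h
  rw [affineChart_eq, affineChart_eq] at h
  exact hb.fintypeLinearCombination_injective (add_left_cancel h)

lemma range_affineChart {d : ℕ} (w : Fin n → ℝ) (b : Fin d → Fin n → ℝ) :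
    Set.range (affineChart w b) = {x | x - w ∈ Submodule.span ℝ (Set.range b)} := by
  ext x
  rw [Set.mem_ofPred_eq, ← Fintype.range_linearCombination, LinearMap.mem_range]
  refine exists_congr fun t => ?_
  rw [affineChart_eq, eq_sub_iff_add_eq']

lemma isCompact_preimage_affineChart {d : ℕ} (w : Fin n → ℝ) {b : Fin d → Fin n → ℝ}
    (hb : LinearIndependent ℝ b) {X : Set (Fin n → ℝ)} (hX : IsCompact X) :
    IsCompact (affineChart w b ⁻¹' X) := by
  have h : Topology.IsClosedEmbedding (affineChart w b) := by
    have h1 : Topology.IsClosedEmbedding (Fintype.linearCombination ℝ b) :=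
      LinearMap.isClosedEmbedding_of_injective
        (LinearMap.ker_eq_bot.2 hb.fintypeLinearCombination_injective)
    have h2 := (Homeomorph.addLeft w).isClosedEmbedding.comp h1
    convert h2 using 1
    ext t : 1
    exact affineChart_eq w b t
  exact h.isCompact_preimage hX

lemma convex_preimage_affineChart {d : ℕ} (w : Fin n → ℝ) (b : Fin d → Fin n → ℝ)
    {X : Set (Fin n → ℝ)} (hX : Convex ℝ X) : Convex ℝ (affineChart w b ⁻¹' X) := by
  rw [← coe_affineChartMap]
  exact hX.affine_preimage _

lemma preimage_affineChart_convexHull_image {d : ℕ} (w : Fin n → ℝ) {b : Fin d → Fin n → ℝ}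
    (hb : LinearIndependent ℝ b) (S : Set (Fin d → ℝ)) :
    affineChart w b ⁻¹' convexHull ℝ (affineChart w b '' S) = convexHull ℝ S := by
  have h := (affineChartMap w b).image_convexHull S
  rw [coe_affineChartMap] at h
  rw [← h, Set.preimage_image_eq _ (affineChart_injective w hb)]

/-! ### The volume of a pyramid -/

/-- The embedding of `ℝᵈ` as the coordinate hyperplane `t₀ = 0` of `ℝᵈ⁺¹`. -/
def zeroCons (d : ℕ) : (Fin d → ℝ) →ₗ[ℝ] (Fin (d + 1) → ℝ) where
  toFun q := Fin.cons 0 q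
  map_add' p q := by
    ext i
    refine Fin.cases ?_ (fun i => ?_) i <;> simp
  map_smul' c q := by
    ext i
    refine Fin.cases ?_ (fun i => ?_) i <;> simp

lemma mem_convexHull_insert_zeroCons {d : ℕ} {Q : Set (Fin d → ℝ)} (hconv : Convex ℝ Q)
    (hne : Q.Nonempty) (v x : Fin (d + 1) → ℝ) :
    x ∈ convexHull ℝ (insert v (zeroCons d '' Q)) ↔
      ∃ s ∈ Icc (0 : ℝ) 1, ∃ q ∈ Q, x = s • v + (1 - s) • zeroCons d q := by
  rw [convexHull_insert (hne.image _), (hconv.linear_image (zeroCons d)).convexHull_eq,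
    convexJoin_singleton_left]
  simp only [mem_iUnion, exists_prop, Set.exists_mem_image]
  constructor
  · rintro ⟨q, hq, a, s, ha, hs, has, rfl⟩
    refine ⟨a, ⟨ha, by linarith⟩, q, hq, ?_⟩
    rw [← has, add_sub_cancel_left]
  · rintro ⟨s, hs, q, hq, rfl⟩
    exact ⟨q, hq, s, 1 - s, hs.1, by linarith [hs.2], by ring, rfl⟩

lemma integral_indicator_one_sub_pow (d : ℕ) :
    ∫ s : ℝ, (Icc (0 : ℝ) 1).indicator (fun s => (1 - s) ^ d) s = 1 / (d + 1) := by
  rw [integral_indicator measurableSet_Icc, integral_Icc_eq_integral_Ioc,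
    ← intervalIntegral.integral_of_le zero_le_one,
    intervalIntegral.integral_comp_sub_left (fun s => s ^ d) 1, integral_pow]
  simp

/-- The volume of a pyramid over `Q` is the height times the volume of `Q`, divided by the
dimension. -/
lemma volume_pyramid {d : ℕ} {Q : Set (Fin d → ℝ)} (hcomp : IsCompact Q) (hconv : Convex ℝ Q)
    (hne : Q.Nonempty) (v : Fin (d + 1) → ℝ) (hv : v 0 ≠ 0) :
    volume.real (convexHull ℝ (insert v (zeroCons d '' Q))) =
      |v 0| / (d + 1) * volume.real Q := by
  set X := convexHull ℝ (insert v (zeroCons d '' Q)) with hX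
  set g : ℝ → ℝ := (Icc (0 : ℝ) 1).indicator (fun s => (1 - s) ^ d) with hg
  have hg0 : ∀ s, 0 ≤ g s := fun s =>
    indicator_nonneg (fun s hs => pow_nonneg (by linarith [hs.2]) _) s
  have hgint : Integrable g := by
    rw [hg, integrable_indicator_iff measurableSet_Icc]
    exact (by fun_prop : Continuous fun s : ℝ => (1 - s) ^ d).continuousOn.integrableOn_Icc
  have hXcomp : IsCompact X := by
    have h : X = (fun p : ℝ × (Fin d → ℝ) => p.1 • v + (1 - p.1) • zeroCons d p.2) ''
        (Icc (0 : ℝ) 1 ×ˢ Q) := by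
      ext x
      rw [hX, mem_convexHull_insert_zeroCons hconv hne]
      constructor
      · rintro ⟨s, hs, q, hq, rfl⟩
        exact ⟨(s, q), ⟨hs, hq⟩, rfl⟩
      · rintro ⟨⟨s, q⟩, ⟨hs, hq⟩, rfl⟩
        exact ⟨s, hs, q, hq, rfl⟩
    rw [h]
    have hc : Continuous (zeroCons d) := LinearMap.continuous_of_finiteDimensional _
    exact (isCompact_Icc.prod hcomp).image (by fun_prop)
  let e := MeasurableEquiv.piFinSuccAbove (fun _ : Fin (d + 1) => ℝ) 0
  have he : MeasurePreserving e.symm :=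
    (volume_preserving_piFinSuccAbove (fun _ : Fin (d + 1) => ℝ) 0).symm _
  -- Cavalieri along coordinate `0`: with `s = t / v 0`, the slice is a translate of `(1 - s) • Q`
  -- for `s ∈ [0, 1]`, and empty otherwise.
  have hslice : ∀ t : ℝ, volume (Prod.mk t ⁻¹' (e.symm ⁻¹' X)) =
      ENNReal.ofReal (g (t / v 0)) * volume Q := by
    intro t
    have hmem : ∀ y : Fin d → ℝ, y ∈ Prod.mk t ⁻¹' (e.symm ⁻¹' X) ↔
        ∃ s ∈ Icc (0 : ℝ) 1, ∃ q ∈ Q, t = s * v 0 ∧ y = s • Fin.tail v + (1 - s) • q := by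
      intro y
      rw [mem_preimage, mem_preimage, hX, mem_convexHull_insert_zeroCons hconv hne]
      have hesymm : e.symm (t, y) = Fin.cons t y := by
        simp only [e, MeasurableEquiv.piFinSuccAbove_symm_apply, Fin.insertNthEquiv_zero]
        rfl
      rw [hesymm]
      refine exists_congr fun s => and_congr_right fun _ => exists_congr fun q =>
        and_congr_right fun _ => ?_
      constructor
      · intro h
        refine ⟨?_, ?_⟩
        · simpa [zeroCons] using congrFun h 0
        · ext i
          simpa [zeroCons, Fin.tail] using congrFun h i.succ
      · rintro ⟨h0, h1⟩
        ext i
        refine Fin.cases ?_ (fun i => ?_) i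
        · simpa [zeroCons] using h0
        · simpa [zeroCons, Fin.tail] using congrFun h1 i
    by_cases ht : t / v 0 ∈ Icc (0 : ℝ) 1
    · have hset : Prod.mk t ⁻¹' (e.symm ⁻¹' X) =
          (fun y => (t / v 0) • Fin.tail v + y) '' ((1 - t / v 0) • Q) := by
        ext y
        rw [hmem]
        constructor
        · rintro ⟨s, -, q, hq, hs, rfl⟩
          have : t / v 0 = s := by rw [hs, mul_div_cancel_right₀ _ hv]
          rw [this]
          exact ⟨_, Set.smul_mem_smul_set hq, rfl⟩
        · rintro ⟨_, ⟨q, hq, rfl⟩, rfl⟩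
          exact ⟨t / v 0, ht, q, hq, (div_mul_cancel₀ _ hv).symm, rfl⟩
      rw [hset, image_add_left, measure_preimage_add, Measure.addHaar_smul, hg,
        indicator_of_mem ht, Module.finrank_fin_fun,
        abs_of_nonneg (pow_nonneg (by linarith [ht.2]) _)]
    · have hset : Prod.mk t ⁻¹' (e.symm ⁻¹' X) = ∅ := by
        ext y
        rw [hmem]
        simp only [mem_empty_iff_false, iff_false]
        rintro ⟨s, hs, q, -, hs', -⟩
        apply ht
        rwa [hs', mul_div_cancel_right₀ _ hv]
      rw [hset, measure_empty, hg, indicator_of_notMem ht, ENNReal.ofReal_zero, zero_mul]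
  have hvol : volume X = ENNReal.ofReal (|v 0| / (d + 1)) * volume Q := by
    rw [← he.measure_preimage hXcomp.measurableSet.nullMeasurableSet, Measure.volume_eq_prod,
      Measure.prod_apply (e.symm.measurable hXcomp.measurableSet)]
    simp_rw [hslice]
    -- Substituting `s = t / v 0` contributes the factor `|v 0|`; the integral of `(1 - s) ^ d`
    -- contributes `1 / (d + 1)`.
    have hcd : Integrable fun t => g (t / v 0) := hgint.comp_div hv
    rw [lintegral_mul_const' _ _ hcomp.measure_lt_top.ne,
      ← ofReal_integral_eq_lintegral_ofReal hcd (Filter.Eventually.of_forall fun t => hg0 _),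
      Measure.integral_comp_div, integral_indicator_one_sub_pow, smul_eq_mul, mul_one_div]
  rw [measureReal_def, hvol, ENNReal.toReal_mul, ENNReal.toReal_ofReal (by positivity),
    measureReal_def]

/-- The corner simplex `conv(0, e₁, …, e_d)`. -/
def cornerSimplex (d : ℕ) : Set (Fin d → ℝ) :=
  convexHull ℝ (insert 0 (Set.range fun i : Fin d => Pi.single i 1))

lemma isCompact_cornerSimplex (d : ℕ) : IsCompact (cornerSimplex d) :=
  ((Set.finite_range _).insert _).isCompact_convexHull ℝ

lemma volume_cornerSimplex_zero : volume.real (cornerSimplex 0) = 1 := by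
  have : cornerSimplex 0 = {0} := by simp [cornerSimplex]
  rw [this, measureReal_def, Set.eq_univ_of_forall (s := {(0 : Fin 0 → ℝ)})
    (fun x => Subsingleton.elim _ _), volume_pi, Measure.pi_univ]
  simp

/-- The corner simplex is a pyramid of height one over the one of lower dimension, so its volume
carries the same factor as any other pyramid. -/
lemma volume_cornerSimplex_succ (d : ℕ) :
    volume.real (cornerSimplex (d + 1)) = volume.real (cornerSimplex d) / (d + 1) := by
  have h : cornerSimplex (d + 1) =
      convexHull ℝ (insert (Pi.single 0 1) (zeroCons d '' cornerSimplex d)) := by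
    rw [cornerSimplex, cornerSimplex, LinearMap.image_convexHull, ← Set.singleton_union,
      ← Set.singleton_union (a := Pi.single 0 1), convexHull_convexHull_union_right]
    congr 1
    ext x
    simp only [Set.image_insert_eq, Set.mem_union, Set.mem_singleton_iff, Set.mem_range,
      Set.mem_insert_iff, map_zero, Fin.exists_fin_succ, Set.mem_image, exists_exists_eq_and]
    have hz : ∀ i : Fin d, zeroCons d (Pi.single i 1) = Pi.single i.succ 1 := by
      intro i
      ext j
      refine Fin.cases ?_ (fun j => ?_) j
      · simp [zeroCons]
      · simp [zeroCons, Pi.single_apply]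
    simp only [hz]
    tauto
  rw [h, volume_pyramid (isCompact_cornerSimplex d) (convex_convexHull ℝ _)
    ⟨0, subset_convexHull ℝ _ (mem_insert _ _)⟩ _ (by simp)]
  simp
  ring

lemma volume_cornerSimplex_pos (d : ℕ) : 0 < volume.real (cornerSimplex d) := by
  induction d with
  | zero => rw [volume_cornerSimplex_zero]; exact one_pos
  | succ d ih => rw [volume_cornerSimplex_succ]; positivity

lemma preimage_affineChart_simplex {d : ℕ} (w : Fin n → ℝ) {b : Fin d → Fin n → ℝ}
    (hb : LinearIndependent ℝ b) :
    affineChart w b ⁻¹' convexHull ℝ (insert w (Set.range fun i => w + b i)) =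
      cornerSimplex d := by
  rw [cornerSimplex, ← preimage_affineChart_convexHull_image w hb, Set.image_insert_eq,
    ← Set.range_comp]
  have h0 : affineChart w b 0 = w := by simp [affineChart]
  have h1 : ∀ i, affineChart w b (Pi.single i 1) = w + b i := by
    intro i
    rw [affineChart_eq, Fintype.linearCombination_apply_single, one_smul]
  simp only [h0, h1, Function.comp_def]

/-! ### Independence of the chart -/

/-- A change of the `ℤ`-basis of the lattice and of the base point preserves volumes. -/
lemma volume_preimage_affineChart_eq {d : ℕ} {L : Submodule ℤ (Fin n → ℝ)}
    (b c : Module.Basis (Fin d) ℤ L) {w w' : Fin n → ℝ}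
    (hw : w' - w ∈ Submodule.span ℝ (Set.range fun i => (b i : Fin n → ℝ)))
    (X : Set (Fin n → ℝ)) :
    volume (affineChart w' (fun i => (c i : Fin n → ℝ)) ⁻¹' X) =
      volume (affineChart w (fun i => (b i : Fin n → ℝ)) ⁻¹' X) := by
  obtain ⟨a, ha⟩ : ∃ a, affineChart w (fun i => (b i : Fin n → ℝ)) a = w' := by
    have : w' ∈ Set.range (affineChart w fun i => (b i : Fin n → ℝ)) := by
      rwa [range_affineChart]
    exact this
  set A : Matrix (Fin d) (Fin d) ℤ := b.toMatrix c with hA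
  have hdet : IsUnit A.det := (Matrix.isUnit_iff_isUnit_det A).1
    (by
      have := b.invertibleToMatrix c
      exact isUnit_of_invertible A)
  set M : (Fin d → ℝ) →ₗ[ℝ] (Fin d → ℝ) := Matrix.toLin' (A.map (Int.cast : ℤ → ℝ)) with hM
  -- A change of ℤ-basis is unimodular, so the real map it induces preserves Lebesgue measure.
  have hMdet : |LinearMap.det M| = 1 := by
    rw [hM, LinearMap.det_toLin']
    have : (A.map (Int.cast : ℤ → ℝ)).det = (A.det : ℝ) :=
      ((Int.castRingHom ℝ).map_det A).symm
    rw [this]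
    rcases Int.isUnit_iff.1 hdet with h | h <;> simp [h]
  have hMne : LinearMap.det M ≠ 0 := by
    intro h
    rw [h, abs_zero] at hMdet
    exact zero_ne_one hMdet
  have hc : ∀ j, (c j : Fin n → ℝ) = ∑ i, (A i j : ℝ) • (b i : Fin n → ℝ) := by
    intro j
    have h := congrArg (Subtype.val) (b.sum_toMatrix_smul_self c j)
    rw [← h, AddSubmonoidClass.coe_finsetSum]
    simp only [hA, Int.cast_smul_eq_zsmul, Submodule.coe_smul]
  have hchart : ∀ t, affineChart w' (fun i => (c i : Fin n → ℝ)) t =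
      affineChart w (fun i => (b i : Fin n → ℝ)) (a + M t) := by
    intro t
    rw [← ha]
    simp only [affineChart, Pi.add_apply, add_smul, Finset.sum_add_distrib, add_assoc, hc,
      Finset.smul_sum, smul_smul]
    congr 2
    rw [Finset.sum_comm]
    refine Finset.sum_congr rfl fun i _ => ?_
    rw [hM, Matrix.toLin'_apply, Matrix.mulVec, dotProduct, Finset.sum_smul]
    refine Finset.sum_congr rfl fun j _ => ?_
    rw [Matrix.map_apply, mul_comm]
  have hset : affineChart w' (fun i => (c i : Fin n → ℝ)) ⁻¹' X =
      M ⁻¹' ((fun t => a + t) ⁻¹' (affineChart w (fun i => (b i : Fin n → ℝ)) ⁻¹' X)) := by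
    ext t
    simp only [mem_preimage, hchart]
  rw [hset, Measure.addHaar_preimage_linearMap _ hMne, measure_preimage_add, abs_inv, hMdet]
  simp

/-- Removes the choices hidden in the definition, so that charts adapted to a facet become
available. -/
lemma latticeVolume_eq {P : Set (Fin n → ℝ)} (hP : IsRationalPolytope P) {d : ℕ}
    (hd : dim P = d) (b : Module.Basis (Fin d) ℤ (directionLattice P)) {w : Fin n → ℝ}
    (hw : w ∈ P) :
    latticeVolume P = volume.real (affineChart w (fun i => (b i : Fin n → ℝ)) ⁻¹' P) /
      volume.real (cornerSimplex d) := by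
  subst hd
  have h : P.Nonempty ∧ Nonempty (Module.Basis (Fin (dim P)) ℤ (directionLattice P)) :=
    ⟨hP.nonempty, hP.nonempty_basis⟩
  rw [latticeVolume, dif_pos h, scaledVolume,
    preimage_affineChart_simplex _ (hP.linearIndependent_basis rfl _), measureReal_def,
    volume_preimage_affineChart_eq b h.2.some (w := w), ← measureReal_def]
  rw [hP.span_basis b]
  exact vsub_mem_vectorSpan ℝ h.1.some_mem hw

/-! ### Lattice heights -/

lemma exists_leftInverse_linearCombination {d : ℕ} {b : Fin d → Fin n → ℝ}
    (hb : LinearIndependent ℝ b) :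
    ∃ ψ : (Fin n → ℝ) →ₗ[ℝ] (Fin d → ℝ), ∀ t, ψ (Fintype.linearCombination ℝ b t) = t := by
  obtain ⟨ψ, hψ⟩ := LinearMap.exists_leftInverse_of_injective (Fintype.linearCombination ℝ b)
    (LinearMap.ker_eq_bot.2 hb.fintypeLinearCombination_injective)
  exact ⟨ψ, fun t => LinearMap.congr_fun hψ t⟩

/-- Adding `v` strictly enlarges the direction space of `G`, and `F` leaves room for only one more
dimension. Thus the lattice in the definition of the height is that of `F`. -/
lemma vectorSpan_insert_eq {F G : Set (Fin n → ℝ)} {v : Fin n → ℝ} (hGF : G ⊆ F) (hv : v ∈ F)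
    (hne : G.Nonempty) (hvG : v ∉ affineSpan ℝ G) (hdim : dim F = dim G + 1) :
    vectorSpan ℝ (insert v G) = vectorSpan ℝ F := by
  have hle : vectorSpan ℝ (insert v G) ≤ vectorSpan ℝ F :=
    vectorSpan_mono ℝ (insert_subset hv hGF)
  refine Submodule.eq_of_le_of_finrank_le hle ?_
  obtain ⟨g, hg⟩ := hne
  have hlt : vectorSpan ℝ G < vectorSpan ℝ (insert v G) := by
    refine lt_of_le_of_ne (vectorSpan_mono ℝ (subset_insert _ _)) fun h => hvG ?_
    have h1 : v -ᵥ g ∈ vectorSpan ℝ (insert v G) :=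
      vsub_mem_vectorSpan ℝ (mem_insert _ _) (mem_insert_of_mem _ hg)
    rw [← h, ← direction_affineSpan] at h1
    exact (AffineSubspace.vsub_right_mem_direction_iff_mem (mem_affineSpan ℝ hg) v).1 h1
  have := Submodule.finrank_lt_finrank_of_lt hlt
  unfold dim at hdim
  omega

/-- The lattice height is the absolute value of the additional coordinate in an adapted basis. -/
lemma latticeHeight_eq {F G : Set (Fin n → ℝ)} (hF : IsRationalPolytope F)
    (hG : IsRationalPolytope G) (hGF : G ⊆ F) {d : ℕ} (hd : dim G = d) (hdF : dim F = d + 1)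
    (b : Module.Basis (Fin d) ℤ (directionLattice G))
    (c : Module.Basis (Fin (d + 1)) ℤ (directionLattice F))
    (hbc : ∀ i, (c (Fin.succ i) : Fin n → ℝ) = b i) {g v : Fin n → ℝ} (hg : g ∈ G) (hv : v ∈ F)
    (hvG : v ∉ affineSpan ℝ G) {t : Fin (d + 1) → ℝ}
    (ht : affineChart g (fun i => (c i : Fin n → ℝ)) t = v) :
    latticeHeight G v = |t 0| := by
  have hc := hF.linearIndependent_basis hdF c
  have hV := vectorSpan_insert_eq hGF hv hG.nonempty hvG (by rw [hdF, hd])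
  have hL : directionLattice (insert v G) = directionLattice F := by
    rw [directionLattice, hV, directionLattice]
  have hgv : g ∈ affineSpan ℝ (insert v G) := mem_affineSpan ℝ (mem_insert_of_mem _ hg)
  have hmem : ∀ y, y ∈ affineSpan ℝ G ↔ y - g ∈ vectorSpan ℝ G := by
    intro y
    rw [← direction_affineSpan, ← vsub_eq_sub,
      AffineSubspace.vsub_right_mem_direction_iff_mem (mem_affineSpan ℝ hg)]
  have hmem' : ∀ y, y ∈ affineSpan ℝ (insert v G) ↔ y - g ∈ vectorSpan ℝ F := by
    intro y
    rw [← hV, ← direction_affineSpan, ← vsub_eq_sub,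
      AffineSubspace.vsub_right_mem_direction_iff_mem hgv]
  have hsum : ∀ z ∈ directionLattice F, ∃ k : Fin (d + 1) → ℤ,
      z = Fintype.linearCombination ℝ (fun i => (c i : Fin n → ℝ)) fun i => (k i : ℝ) := by
    intro z hz
    refine ⟨c.repr ⟨z, hz⟩, ?_⟩
    have h := congrArg Subtype.val (c.sum_repr ⟨z, hz⟩)
    rw [AddSubmonoidClass.coe_finsetSum] at h
    rw [Fintype.linearCombination_apply]
    simp only [Submodule.coe_smul] at h
    simp only [Int.cast_smul_eq_zsmul]
    exact h.symm
  rw [latticeHeight, if_neg hvG]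
  have hex : ∃ r, IsHeightValue G v r := by
    obtain ⟨ψ, hψ⟩ := exists_leftInverse_linearCombination hc
    -- The form is the zeroth coordinate with respect to `c`: integral on the lattice, one on `c 0`,
    -- zero on the direction space of `G`.
    refine ⟨_, LinearMap.proj 0 ∘ₗ ψ, ψ g 0, ?_, ?_, ?_, rfl⟩
    · intro z hz
      rw [hL] at hz
      obtain ⟨k, rfl⟩ := hsum z hz
      exact ⟨k 0, by simp [hψ]⟩
    · refine ⟨c 0, by rw [hL]; exact (c 0).2, ?_⟩
      have h := hψ (Pi.single 0 1)
      rw [Fintype.linearCombination_apply_single, one_smul] at h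
      simp [h]
    · intro y hy
      rw [hmem', ← hF.span_basis c, ← Fintype.range_linearCombination] at hy
      obtain ⟨s, hs⟩ := hy
      rw [hmem]
      have hy0 : (LinearMap.proj 0 ∘ₗ ψ) y = ψ g 0 ↔ s 0 = 0 := by
        have : ψ y - ψ g = s := by rw [← map_sub, ← hs, hψ]
        rw [← this]
        simp [sub_eq_zero]
      rw [hy0, ← hs]
      constructor
      · intro h
        rw [← hG.span_basis b, ← Fintype.range_linearCombination] at h
        obtain ⟨r, hr⟩ := h
        have : Fintype.linearCombination ℝ (fun i => (c i : Fin n → ℝ)) (zeroCons d r) =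
            Fintype.linearCombination ℝ (fun i => (c i : Fin n → ℝ)) s := by
          rw [← hr, Fintype.linearCombination_apply, Fintype.linearCombination_apply,
            Fin.sum_univ_succ]
          simp [zeroCons, hbc]
        rw [← hc.fintypeLinearCombination_injective this]
        simp [zeroCons]
      · intro h
        rw [Fintype.linearCombination_apply, Fin.sum_univ_succ, h, zero_smul, zero_add]
        refine Submodule.sum_mem _ fun i _ => Submodule.smul_mem _ _ ?_
        rw [hbc]
        exact (b i).2.1
  rw [dif_pos hex]
  -- The chosen form is unknown, but any admissible one kills the vectors `c i.succ` and takes on `c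
  -- 0` an integer dividing one. So it agrees up to sign with the coordinate form.
  obtain ⟨l, β, hint, ⟨z, hz, hz1⟩, haff, hr⟩ := hex.choose_spec
  rw [hL] at hint hz
  have hβ : β = l g := ((haff g hgv).1 (mem_affineSpan ℝ hg)).symm
  have hl0 : ∀ i : Fin d, l (c i.succ) = 0 := by
    intro i
    have h1 : (c i.succ : Fin n → ℝ) ∈ vectorSpan ℝ G := by
      rw [hbc]
      exact (b i).2.1
    have h2 : g + (c i.succ : Fin n → ℝ) ∈ affineSpan ℝ G := by
      rw [hmem, add_sub_cancel_left]
      exact h1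
    have h3 := (haff _ (affineSpan_mono ℝ (subset_insert _ _) h2)).1 h2
    rw [map_add, hβ] at h3
    linarith
  have hl : ∀ s, l (Fintype.linearCombination ℝ (fun i => (c i : Fin n → ℝ)) s) =
      s 0 * l (c 0) := by
    intro s
    rw [Fintype.linearCombination_apply, map_sum, Fin.sum_univ_succ]
    simp [hl0]
  obtain ⟨m, hm⟩ := hint (c 0) (c 0).2
  obtain ⟨k, hk⟩ := hsum z hz
  have habs : |l (c 0)| = 1 := by
    rw [hk, hl, hm] at hz1
    have : k 0 * m = 1 := by exact_mod_cast hz1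
    rw [hm]
    rcases Int.eq_one_or_neg_one_of_mul_eq_one (show m * k 0 = 1 by rw [mul_comm]; exact this)
      with h | h <;> simp [h]
  rw [hr, hβ, ← ht, affineChart_eq, map_add, add_sub_cancel_left, hl, abs_mul, habs, mul_one]

/-- The lattice volume of a pyramid is the lattice height times the lattice volume of the base. -/
lemma pyramid_latticeVolume {F G : Set (Fin n → ℝ)} (hF : IsRationalPolytope F)
    (hG : IsRationalPolytope G) (hGF : G ⊆ F) {d : ℕ} (hd : dim G = d) (hdF : dim F = d + 1)
    (b : Module.Basis (Fin (d + 1)) ℤ (directionLattice F)) {w v : Fin n → ℝ} (hw : w ∈ F)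
    (hv : v ∈ F) (hvG : v ∉ affineSpan ℝ G) :
    volume.real (affineChart w (fun i => (b i : Fin n → ℝ)) ⁻¹' convexHull ℝ (insert v G)) /
      volume.real (cornerSimplex (d + 1)) = latticeHeight G v * latticeVolume G := by
  obtain ⟨a⟩ := hG.nonempty_basis
  subst hd
  obtain ⟨c, hc⟩ := exists_adapted_basis hF hG hGF rfl hdF a
  obtain ⟨g, hg⟩ := hG.nonempty
  have hcl := hF.linearIndependent_basis hdF c
  have hal := hG.linearIndependent_basis rfl a
  have hrange : ∀ x ∈ F, x ∈ Set.range (affineChart g fun i => (c i : Fin n → ℝ)) := by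
    intro x hx
    rw [range_affineChart, Set.mem_ofPred_eq, hF.span_basis c]
    exact vsub_mem_vectorSpan ℝ hx (hGF hg)
  obtain ⟨t, ht⟩ := hrange v hv
  have hrangeG : G ⊆ Set.range (affineChart g fun i => (a i : Fin n → ℝ)) := by
    intro x hx
    rw [range_affineChart, Set.mem_ofPred_eq, hG.span_basis a]
    exact vsub_mem_vectorSpan ℝ hx hg
  set Q := affineChart g (fun i => (a i : Fin n → ℝ)) ⁻¹' G with hQ
  have hchart : ∀ q, affineChart g (fun i => (c i : Fin n → ℝ)) (zeroCons _ q) =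
      affineChart g (fun i => (a i : Fin n → ℝ)) q := by
    intro q
    rw [affineChart, affineChart, Fin.sum_univ_succ]
    simp [zeroCons, hc]
  have himage : insert v G =
      affineChart g (fun i => (c i : Fin n → ℝ)) '' insert t (zeroCons _ '' Q) := by
    rw [Set.image_insert_eq, ht, Set.image_image]
    simp only [hchart]
    rw [hQ, Set.image_preimage_eq_of_subset hrangeG]
  have hh := latticeHeight_eq hF hG hGF rfl hdF a c hc hg hv hvG ht
  have ht0 : t 0 ≠ 0 := by
    intro h
    apply hvG
    rw [← ht, affineChart, Fin.sum_univ_succ, h, zero_smul, zero_add]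
    have : ∑ i : Fin (dim G), t i.succ • (c i.succ : Fin n → ℝ) ∈ vectorSpan ℝ G :=
      Submodule.sum_mem _ fun i _ => Submodule.smul_mem _ _ (by rw [hc]; exact (a i).2.1)
    rw [add_comm]
    exact AffineSubspace.vadd_mem_of_mem_direction (by rwa [direction_affineSpan])
      (mem_affineSpan ℝ hg)
  have hQne : Q.Nonempty := by
    obtain ⟨q, hq⟩ := hrangeG hg
    exact ⟨q, by rw [hQ, mem_preimage, hq]; exact hg⟩
  rw [latticeVolume_eq hG rfl a hg, hh, measureReal_def,
    ← volume_preimage_affineChart_eq b c (w' := g), ← measureReal_def, himage,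
    preimage_affineChart_convexHull_image g hcl, volume_pyramid
      (isCompact_preimage_affineChart g hal hG.isCompact)
      (convex_preimage_affineChart g _ hG.convex) hQne t ht0, volume_cornerSimplex_succ]
  · have := (volume_cornerSimplex_pos (dim G)).ne'
    field_simp
  · rw [hF.span_basis b]
    exact vsub_mem_vectorSpan ℝ (hGF hg) hw

/-! ### Faces and supporting forms -/

lemma IsFace.subset {F G : Set (Fin n → ℝ)} (h : IsFace G F) : G ⊆ F := h.2.subset

lemma IsFace.exists_form {F G : Set (Fin n → ℝ)} (h : IsFace G F) :
    ∃ (l : (Fin n → ℝ) →ₗ[ℝ] ℝ) (c : ℝ), (∀ x ∈ F, l x ≤ c) ∧ ∀ x, x ∈ G ↔ x ∈ F ∧ l x = c := by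
  obtain ⟨g, hg⟩ := h.1
  obtain ⟨l, rfl⟩ := h.2 h.1
  refine ⟨l.toLinearMap, l g, fun x hx => hg.2 x hx, fun x => ?_⟩
  constructor
  · rintro ⟨hx, hmax⟩
    exact ⟨hx, le_antisymm (hg.2 x hx) (hmax g hg.1)⟩
  · rintro ⟨hx, hlx⟩
    refine ⟨hx, fun y hy => ?_⟩
    have : l x = l g := hlx
    rw [this]
    exact hg.2 y hy

lemma apply_eq_of_mem_affineSpan {G : Set (Fin n → ℝ)} {l : (Fin n → ℝ) →ₗ[ℝ] ℝ} {c : ℝ}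
    (h : ∀ x ∈ G, l x = c) {x : Fin n → ℝ} (hx : x ∈ affineSpan ℝ G) : l x = c := by
  obtain ⟨g, hg⟩ := (affineSpan_nonempty ℝ).1 ⟨x, hx⟩
  have hle : affineSpan ℝ G ≤ AffineSubspace.mk' g (LinearMap.ker l) := by
    rw [affineSpan_le]
    intro y hy
    simp [AffineSubspace.mem_mk', h y hy, h g hg]
  have := hle hx
  rw [AffineSubspace.mem_mk', LinearMap.mem_ker, vsub_eq_sub, map_sub, h g hg] at this
  linarith

/-- A supporting form is constant on the affine hull of `G`, and `F` attains that value only on `G`.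
-/
lemma IsFace.notMem_affineSpan {F G : Set (Fin n → ℝ)} (h : IsFace G F) {v : Fin n → ℝ}
    (hv : v ∈ F) (hvG : v ∉ G) : v ∉ affineSpan ℝ G := by
  obtain ⟨l, c, -, hG⟩ := h.exists_form
  exact fun hmem => hvG
    ((hG v).2 ⟨hv, apply_eq_of_mem_affineSpan (fun x hx => ((hG x).1 hx).2) hmem⟩)

lemma IsFace.dim_lt {F G : Set (Fin n → ℝ)} (h : IsFace G F) (hne : G ≠ F) :
    dim G < dim F := by
  obtain ⟨x, hxF, hxG⟩ := Set.exists_of_ssubset (h.subset.ssubset_of_ne hne)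
  obtain ⟨g, hg⟩ := h.1
  refine Submodule.finrank_lt_finrank_of_lt
    (lt_of_le_of_ne (vectorSpan_mono ℝ h.subset) fun heq => ?_)
  have h1 : x -ᵥ g ∈ vectorSpan ℝ F := vsub_mem_vectorSpan ℝ hxF (h.subset hg)
  rw [← heq, ← direction_affineSpan] at h1
  exact h.notMem_affineSpan hxF hxG
    ((AffineSubspace.vsub_right_mem_direction_iff_mem (mem_affineSpan ℝ hg) x).1 h1)

/-! ### The decomposition of a polytope into pyramids -/

lemma convexHull_insert_subset_affineSpan (v : Fin n → ℝ) (G : Set (Fin n → ℝ)) :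
    convexHull ℝ (insert v G) ⊆ affineSpan ℝ (insert v G) :=
  convexHull_subset_affineSpan _

/-- The preimage is an affine subspace of ℝᵈ, proper because the chart covers `F`. -/
lemma volume_preimage_affineSubspace {d : ℕ} {F : Set (Fin n → ℝ)} {w : Fin n → ℝ}
    {b : Fin d → Fin n → ℝ} (hF : F ⊆ Set.range (affineChart w b))
    {A : AffineSubspace ℝ (Fin n → ℝ)} (hA : ¬ F ⊆ A) :
    volume (affineChart w b ⁻¹' A) = 0 := by
  have h : affineChart w b ⁻¹' A = (A.comap (affineChartMap w b) : Set (Fin d → ℝ)) := by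
    rw [AffineSubspace.coe_comap, coe_affineChartMap]
  rw [h]
  refine Measure.addHaar_affineSubspace _ _ fun htop => hA fun x hx => ?_
  obtain ⟨t, rfl⟩ := hF hx
  have ht : t ∈ A.comap (affineChartMap w b) := htop ▸ AffineSubspace.mem_top ℝ _ t
  rw [AffineSubspace.mem_comap, coe_affineChartMap] at ht
  exact ht

lemma not_subset_affineSpan {F G : Set (Fin n → ℝ)} (h : dim G < dim F) :
    ¬ F ⊆ affineSpan ℝ G := by
  intro hsub
  have h1 := Submodule.finrank_mono (AffineSubspace.direction_le (affineSpan_le.2 hsub))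
  rw [direction_affineSpan, direction_affineSpan] at h1
  exact h.not_ge h1

lemma not_subset_affineSpan_insert {F G : Set (Fin n → ℝ)} (h : dim G + 1 < dim F)
    (v : Fin n → ℝ) : ¬ F ⊆ affineSpan ℝ (insert v G) :=
  not_subset_affineSpan ((finrank_vectorSpan_insert_le_set ℝ G v).trans_lt h)

lemma dim_singleton (v : Fin n → ℝ) : dim {v} = 0 := by
  rw [dim, vectorSpan_singleton, finrank_bot]

/-- The last point of a compact set on a ray that starts in the set. -/
lemma exists_exit_point {E : Type*} [NormedAddCommGroup E] [NormedSpace ℝ E] {Q : Set E}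
    (hQ : IsCompact Q) {v x : E} (hx : x ∈ Q) (hxv : x ≠ v) :
    ∃ t : ℝ, 1 ≤ t ∧ v + t • (x - v) ∈ Q ∧ v + t • (x - v) ∉ interior Q := by
  have hsub : x - v ≠ 0 := sub_ne_zero.2 hxv
  have hemb : Topology.IsClosedEmbedding fun t : ℝ => v + t • (x - v) :=
    (Homeomorph.addLeft v).isClosedEmbedding.comp (isClosedEmbedding_smul_left hsub)
  have hT : IsCompact ((fun t : ℝ => v + t • (x - v)) ⁻¹' Q) := hemb.isCompact_preimage hQ
  have h1 : (1 : ℝ) ∈ (fun t : ℝ => v + t • (x - v)) ⁻¹' Q := by simpa using hx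
  obtain ⟨t, ht, hmax⟩ := hT.exists_isGreatest ⟨1, h1⟩
  refine ⟨t, hmax h1, ht, fun hint => ?_⟩
  have hopen : IsOpen ((fun t : ℝ => v + t • (x - v)) ⁻¹' interior Q) :=
    isOpen_interior.preimage hemb.continuous
  obtain ⟨ε, hε, hball⟩ := Metric.isOpen_iff.1 hopen t hint
  have hmem : t + ε / 2 ∈ Metric.ball t ε := by
    rw [Metric.mem_ball, Real.dist_eq, add_sub_cancel_left, abs_of_pos (half_pos hε)]
    exact half_lt_self hε
  have h2 : v + (t + ε / 2) • (x - v) ∈ interior Q := hball hmem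
  have := hmax (show t + ε / 2 ∈ (fun t : ℝ => v + t • (x - v)) ⁻¹' Q from
    mem_preimage.2 (interior_subset h2))
  linarith

/-- Every point of the relative interior other than `v` lies in a pyramid with apex `v` over a
proper face. -/
lemma exists_face_of_mem_interior {d : ℕ} {F : Set (Fin n → ℝ)} (hF : IsRationalPolytope F)
    {w : Fin n → ℝ} {b : Fin d → Fin n → ℝ} (hb : LinearIndependent ℝ b)
    (hrange : F ⊆ Set.range (affineChart w b)) {v : Fin n → ℝ} (hv : v ∈ F) {x : Fin d → ℝ}
    (hx : x ∈ interior (affineChart w b ⁻¹' F)) (hxv : affineChart w b x ≠ v) :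
    ∃ G, IsFace G F ∧ G ≠ F ∧ affineChart w b x ∈ convexHull ℝ (insert v G) := by
  obtain ⟨u, rfl⟩ := hrange hv
  set Q := affineChart w b ⁻¹' F with hQ
  have hxu : x ≠ u := fun h => hxv (by rw [h])
  have hQc : IsCompact Q := isCompact_preimage_affineChart w hb hF.isCompact
  have hQconv : Convex ℝ Q := convex_preimage_affineChart w b hF.convex
  obtain ⟨t, ht, hyQ, hyint⟩ := exists_exit_point hQc (v := u) (interior_subset hx) hxu
  set y := u + t • (x - u) with hy
  -- A form supporting at the exit point `y` and strictly smaller on the interior: it exposes a face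
  -- through `y`, which is proper since it misses `x`.
  obtain ⟨l, hl⟩ := geometric_hahn_banach_open_point hQconv.interior isOpen_interior hyint
  have hle : ∀ z ∈ Q, l z ≤ l y := by
    intro z hz
    have hcl : z ∈ closure (interior Q) := by
      rw [hQconv.closure_interior_eq_closure_of_nonempty_interior ⟨x, hx⟩]
      exact subset_closure hz
    exact closure_minimal (fun z hz => (hl z hz).le) (isClosed_le l.continuous continuous_const)
      hcl
  obtain ⟨ψ, hψ⟩ := exists_leftInverse_linearCombination hb
  set m : (Fin n → ℝ) →L[ℝ] ℝ := (l.toLinearMap ∘ₗ ψ).toContinuousLinearMap with hm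
  have hmφ : ∀ z, m (affineChart w b z) = m w + l z := by
    intro z
    rw [affineChart_eq, map_add]
    simp [hm, hψ]
  have hyG : affineChart w b y ∈ m.toExposed F := by
    refine ⟨hyQ, fun p hp => ?_⟩
    obtain ⟨z, rfl⟩ := hrange hp
    rw [hmφ, hmφ]
    linarith [hle z hp]
  refine ⟨m.toExposed F, ⟨⟨_, hyG⟩, ContinuousLinearMap.toExposed.isExposed⟩, fun h => ?_, ?_⟩
  · have hxG : affineChart w b x ∈ m.toExposed F := by
      rw [h]
      exact (interior_subset hx : x ∈ Q)
    have h1 := hxG.2 _ hyQ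
    rw [hmφ, hmφ] at h1
    linarith [hl x hx]
  · have ht0 : t ≠ 0 := by linarith
    have hxy : x = (1 - t⁻¹) • u + t⁻¹ • y := by
      rw [hy, smul_add, smul_smul, inv_mul_cancel₀ ht0, one_smul, sub_smul, one_smul]
      abel
    have hseg : affineChart w b x =
        (1 - t⁻¹) • affineChart w b u + t⁻¹ • affineChart w b y := by
      rw [← coe_affineChartMap]
      conv_lhs => rw [hxy]
      exact Convex.combo_affine_apply (by ring)
    rw [hseg]
    refine convex_convexHull ℝ _ (subset_convexHull ℝ _ (mem_insert _ _))
      (subset_convexHull ℝ _ (mem_insert_of_mem _ hyG)) ?_ (by positivity) (by ring)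
    rw [sub_nonneg]
    exact inv_le_one_of_one_le₀ ht

lemma exists_segment_of_mem_convexHull_insert {G : Set (Fin n → ℝ)} (hG : Convex ℝ G)
    (hne : G.Nonempty) {v x : Fin n → ℝ} (hx : x ∈ convexHull ℝ (insert v G)) :
    ∃ s : ℝ, 0 ≤ s ∧ ∃ g ∈ G, x - v = s • (g - v) := by
  rw [convexHull_insert hne, hG.convexHull_eq, convexJoin_singleton_left] at hx
  simp only [mem_iUnion, exists_prop] at hx
  obtain ⟨g, hg, a, s, -, hs, has, rfl⟩ := hx
  refine ⟨s, hs, g, hg, ?_⟩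
  rw [show a = 1 - s by linarith]
  module

/-- Pyramids with the same apex over distinct faces that do not contain the apex meet in a null
set. -/
lemma volume_inter_pyramids {d : ℕ} {F : Set (Fin n → ℝ)}
    {w : Fin n → ℝ} {b : Fin d → Fin n → ℝ} (hF : F ⊆ Set.range (affineChart w b))
    (hconv : Convex ℝ F) {v : Fin n → ℝ} (hv : v ∈ F) {G G' : Set (Fin n → ℝ)}
    (hG : IsFace G F) (hG' : IsFace G' F) (hvG : v ∉ G) (hvG' : v ∉ G') (hne : G ≠ G') :
    volume (affineChart w b ⁻¹' convexHull ℝ (insert v G) ∩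
      affineChart w b ⁻¹' convexHull ℝ (insert v G')) = 0 := by
  obtain ⟨l, c, hlc, hlG⟩ := hG.exists_form
  obtain ⟨l', c', hlc', hlG'⟩ := hG'.exists_form
  have hpos : 0 < c - l v := by
    have := lt_of_le_of_ne (hlc v hv) fun h => hvG ((hlG v).2 ⟨hv, h⟩)
    linarith
  have hpos' : 0 < c' - l' v := by
    have := lt_of_le_of_ne (hlc' v hv) fun h => hvG' ((hlG' v).2 ⟨hv, h⟩)
    linarith
  -- Normalize both supporting forms to be `0` at `v` and `1` on their faces; `m` is their
  -- difference with denominators cleared.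
  set m : (Fin n → ℝ) →ₗ[ℝ] ℝ := (c' - l' v) • l - (c - l v) • l' with hm
  have hmem : ∀ x, x ∈ AffineSubspace.mk' v (LinearMap.ker m) ↔
      (c' - l' v) * (l x - l v) = (c - l v) * (l' x - l' v) := by
    intro x
    rw [AffineSubspace.mem_mk', LinearMap.mem_ker, hm, vsub_eq_sub]
    simp only [LinearMap.sub_apply, LinearMap.smul_apply, map_sub, smul_eq_mul]
    constructor <;> intro h <;> linarith
  refine measure_mono_null (t := affineChart w b ⁻¹' AffineSubspace.mk' v (LinearMap.ker m)) ?_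
    (volume_preimage_affineSubspace hF fun hsub => hne ?_)
  · rintro x ⟨hx, hx'⟩
    obtain ⟨s, hs, g, hg, hxs⟩ := exists_segment_of_mem_convexHull_insert
      (hG.2.convex hconv) hG.1 hx
    obtain ⟨s', hs', g', hg', hxs'⟩ := exists_segment_of_mem_convexHull_insert
      (hG'.2.convex hconv) hG'.1 hx'
    have e1 : l (affineChart w b x) - l v = s * (c - l v) := by
      rw [← map_sub, hxs, map_smul, map_sub, ((hlG g).1 hg).2, smul_eq_mul]
    have e2 : l (affineChart w b x) - l v = s' * (l g' - l v) := by
      rw [← map_sub, hxs', map_smul, map_sub, smul_eq_mul]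
    have e3 : l' (affineChart w b x) - l' v = s' * (c' - l' v) := by
      rw [← map_sub, hxs', map_smul, map_sub, ((hlG' g').1 hg').2, smul_eq_mul]
    have e4 : l' (affineChart w b x) - l' v = s * (l' g - l' v) := by
      rw [← map_sub, hxs, map_smul, map_sub, smul_eq_mul]
    -- A point over both bases has normalized values `s` and `s'`. As `g'` lies in `F`, its first
    -- normalized value is at most one, so `s ≤ s'`; by symmetry the two agree.
    have h1 : s ≤ s' := by
      refine le_of_mul_le_mul_right ?_ hpos
      rw [← e1, e2]
      exact mul_le_mul_of_nonneg_left (by linarith [hlc g' (hG'.subset hg')]) hs'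
    have h2 : s' ≤ s := by
      refine le_of_mul_le_mul_right ?_ hpos'
      rw [← e3, e4]
      exact mul_le_mul_of_nonneg_left (by linarith [hlc' g (hG.subset hg)]) hs
    rw [mem_preimage, SetLike.mem_coe, hmem, e1, e3, le_antisymm h1 h2]
    ring
  -- If `m` were constant on `F`, the two normalized forms would agree there and expose the same
  -- face.
  · ext x
    rw [hlG, hlG']
    refine and_congr_right fun hx => ?_
    have h := (hmem x).1 (hsub hx)
    constructor
    · intro hlx
      rw [hlx, mul_comm] at h
      linarith [mul_left_cancel₀ hpos.ne' h]
    · intro hlx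
      rw [hlx, mul_comm (c - l v)] at h
      linarith [mul_left_cancel₀ hpos'.ne' h]

/-- The pyramid spans too little: for a facet containing `v` it stays in the affine hull of `G`, and
a face of higher codimension gains at most one dimension from `v`. -/
lemma volume_preimage_pyramid_eq_zero {d : ℕ} {F : Set (Fin n → ℝ)} {w : Fin n → ℝ}
    {b : Fin d → Fin n → ℝ} (hF : F ⊆ Set.range (affineChart w b)) {v : Fin n → ℝ}
    {G : Set (Fin n → ℝ)} (hG : IsFace G F) (hne : G ≠ F) (hv : IsFacet G F → v ∈ G) :
    volume (affineChart w b ⁻¹' convexHull ℝ (insert v G)) = 0 := by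
  refine measure_mono_null (preimage_mono (convexHull_insert_subset_affineSpan v G))
    (volume_preimage_affineSubspace hF ?_)
  have hlt := hG.dim_lt hne
  by_cases hfacet : IsFacet G F
  · rw [insert_eq_of_mem (hv hfacet)]
    exact not_subset_affineSpan hlt
  · have : dim G + 1 ≠ dim F := fun h => hfacet ⟨hG, h⟩
    exact not_subset_affineSpan_insert (by omega) v

open Classical in
/-- The lattice volume of a polytope is the sum of the lattice volumes of the pyramids over the
facets not containing a given point `v` of the polytope. -/
theorem latticeVolume_eq_sum_facets {F : Set (Fin n → ℝ)} (hF : IsRationalPolytope F)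
    (hdim : 0 < dim F) {v : Fin n → ℝ} (hv : v ∈ F) (𝓕 : Finset (Set (Fin n → ℝ)))
    (h𝓕 : ∀ G, G ∈ 𝓕 ↔ IsFacet G F ∧ v ∉ G) :
    latticeVolume F = ∑ G ∈ 𝓕, latticeHeight G v * latticeVolume G := by
  obtain ⟨d, hd⟩ : ∃ d, dim F = d + 1 := ⟨dim F - 1, by omega⟩
  obtain ⟨b⟩ := hF.nonempty_basis
  rw [hd] at b
  set φ := affineChart v (fun i => (b i : Fin n → ℝ)) with hφ
  have hb := hF.linearIndependent_basis hd b
  have hrange : F ⊆ Set.range φ := by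
    intro x hx
    rw [hφ, range_affineChart, Set.mem_ofPred_eq, hF.span_basis b]
    exact vsub_mem_vectorSpan ℝ hx hv
  have hpyr : ∀ G ∈ 𝓕, latticeHeight G v * latticeVolume G =
      volume.real (φ ⁻¹' convexHull ℝ (insert v G)) / volume.real (cornerSimplex (d + 1)) := by
    intro G hG
    obtain ⟨hfacet, hvG⟩ := (h𝓕 G).1 hG
    exact (pyramid_latticeVolume hF (hF.face hfacet.1) hfacet.1.subset
      (by have := hfacet.2; omega) hd b hv hv (hfacet.1.notMem_affineSpan hv hvG)).symm
  rw [latticeVolume_eq hF hd b hv, Finset.sum_congr rfl hpyr, ← Finset.sum_div]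
  congr 1
  have hcomp : ∀ G ∈ 𝓕, IsCompact (φ ⁻¹' convexHull ℝ (insert v G)) := by
    intro G hG
    obtain ⟨hfacet, hvG⟩ := (h𝓕 G).1 hG
    have hGp := hF.face hfacet.1
    refine isCompact_preimage_affineChart v hb ?_
    obtain ⟨S, hS, -, rfl, -⟩ := exists_polytope_generators hGp
    rw [← Set.singleton_union, convexHull_convexHull_union_right]
    exact ((Set.finite_singleton v).union hS).isCompact_convexHull ℝ
  rw [← measureReal_biUnion_finset₀ (μ := volume) ?_
    (fun G hG => (hcomp G hG).measurableSet.nullMeasurableSet)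
    (fun G hG => (hcomp G hG).measure_lt_top.ne)]
  · have hsub : (⋃ G ∈ 𝓕, φ ⁻¹' convexHull ℝ (insert v G)) ⊆ φ ⁻¹' F := by
      refine iUnion₂_subset fun G hG => preimage_mono (convexHull_min ?_ hF.convex)
      exact insert_subset hv ((h𝓕 G).1 hG).1.1.subset
    refine (measureReal_congr (Filter.EventuallyLE.antisymm hsub.eventuallyLE ?_)).symm
    rw [ae_le_set]
    -- The exceptional set: the relative boundary, the point `v`, and the finitely many null
    -- pyramids over faces.
    have hnull : volume (frontier (φ ⁻¹' F) ∪ φ ⁻¹' (affineSpan ℝ {v}) ∪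
        ⋃ G ∈ {G | IsFace G F ∧ volume (φ ⁻¹' convexHull ℝ (insert v G)) = 0},
          φ ⁻¹' convexHull ℝ (insert v G)) = 0 := by
      refine measure_union_null (measure_union_null ?_ ?_) ?_
      · exact (convex_preimage_affineChart _ _ hF.convex).addHaar_frontier _
      · exact volume_preimage_affineSubspace hrange
          (not_subset_affineSpan (by rw [dim_singleton]; exact hdim))
      · exact (measure_biUnion_null_iff
          (hF.finite_faces.subset fun G hG => hG.1).countable).2 fun G hG => hG.2
    refine measure_mono_null ?_ hnull
    rintro x ⟨hxF, hx⟩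
    by_cases hxint : x ∈ interior (φ ⁻¹' F)
    · by_cases hxv : φ x = v
      · refine Or.inl (Or.inr ?_)
        rw [mem_preimage, hxv]
        exact mem_affineSpan ℝ rfl
      · obtain ⟨G, hG, hGF, hxG⟩ := exists_face_of_mem_interior hF hb hrange hv hxint hxv
        refine Or.inr (mem_iUnion₂.2 ⟨G, ⟨hG, ?_⟩, hxG⟩)
        refine volume_preimage_pyramid_eq_zero hrange hG hGF fun hfacet => ?_
        by_contra hvG
        exact hx (mem_iUnion₂.2 ⟨G, (h𝓕 G).2 ⟨hfacet, hvG⟩, hxG⟩)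
    · exact Or.inl (Or.inl ⟨subset_closure hxF, hxint⟩)
  · intro G hG G' hG' hne
    obtain ⟨h1, h2⟩ := (h𝓕 G).1 hG
    obtain ⟨h1', h2'⟩ := (h𝓕 G').1 hG'
    exact volume_inter_pyramids hrange hF.convex hv h1.1 h1'.1 h2 h2' hne

/-! ### Weights in a descent system -/

namespace DescentSystem

variable {P : Set (Fin n → ℝ)} (D : DescentSystem P)

/-- `G` is a facet of the nonsimplex `F` that does not contain the chosen vertex of `F`. -/
def Descends (F G : Set (Fin n → ℝ)) : Prop :=
  ¬ IsSimplex F ∧ IsFacet G F ∧ D.apex F ∉ G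

lemma isFlag_succ_iff {k : ℕ} (f : Fin (k + 1 + 1) → Set (Fin n → ℝ)) :
    D.IsFlag f ↔ D.IsFlag (fun i : Fin (k + 1) => f i.castSucc) ∧
      f (Fin.last (k + 1)) ∈ D.layer (k + 1) ∧
      D.Descends (f (Fin.last k).castSucc) (f (Fin.last (k + 1))) := by
  have h1 := Fin.forall_fin_succ' (P := fun i : Fin (k + 1 + 1) => f i ∈ D.layer i)
  have h2 := Fin.forall_fin_succ' (P := fun i : Fin (k + 1) => D.Descends (f i.castSucc) (f i.succ))
  simp only [Fin.val_castSucc, Fin.val_last, Fin.succ_castSucc, Fin.succ_last] at h1 h2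
  refine (and_congr h1 h2).trans ?_
  unfold IsFlag Descends
  simp only
  tauto

open Classical in
lemma weight_zero : D.weight 0 P = 1 := by
  have h : ((Fintype.piFinset fun i : Fin (0 + 1) => D.layer i).filter
      fun f => D.IsFlag f ∧ f (Fin.last 0) = P) = {fun _ => P} := by
    ext f
    rw [Finset.mem_filter, Fintype.mem_piFinset, Finset.mem_singleton]
    constructor
    · rintro ⟨-, -, h⟩
      ext i : 1
      rwa [show i = Fin.last 0 from Fin.fin_one_eq_zero i]
    · rintro rfl
      have hmem : ∀ i : Fin (0 + 1), P ∈ D.layer i := by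
        intro i
        rw [show i = 0 from Fin.fin_one_eq_zero i]
        simp [D.layer_zero]
      exact ⟨hmem, ⟨hmem, fun i => i.elim0⟩, rfl⟩
  rw [weight, h, Finset.sum_singleton]
  simp

open Classical in
-- Flags ending in `G` are grouped by their penultimate face; the last height then factors out of
-- the product.
lemma weight_succ {k : ℕ} {G : Set (Fin n → ℝ)} (hG : G ∈ D.layer (k + 1)) :
    D.weight (k + 1) G = ∑ F ∈ D.layer k with D.Descends F G,
      D.weight k F * latticeHeight G (D.apex F) := by
  simp_rw [weight, Finset.sum_mul]
  rw [Finset.sum_sigma']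
  refine Finset.sum_bij'
    (i := fun (f : Fin (k + 1 + 1) → Set (Fin n → ℝ)) _ =>
      (⟨f (Fin.last k).castSucc, fun i => f i.castSucc⟩ :
        (_ : Set (Fin n → ℝ)) × (Fin (k + 1) → Set (Fin n → ℝ))))
    (j := fun p _ => (Fin.snoc p.2 G : Fin (k + 1 + 1) → Set (Fin n → ℝ))) ?_ ?_ ?_ ?_ ?_
  · intro f hf
    simp only [Finset.mem_filter, Fintype.mem_piFinset, isFlag_succ_iff] at hf
    obtain ⟨hmem, ⟨hflag, -, hdesc⟩, rfl⟩ := hf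
    simp only [Finset.mem_sigma, Finset.mem_filter, Fintype.mem_piFinset]
    exact ⟨⟨hmem (Fin.last k).castSucc, hdesc⟩, fun i => hmem i.castSucc, hflag, trivial⟩
  · rintro ⟨F, f⟩ hf
    simp only [Finset.mem_sigma, Finset.mem_filter, Fintype.mem_piFinset] at hf
    obtain ⟨⟨hF, hdesc⟩, hmem, hflag, rfl⟩ := hf
    simp only [Finset.mem_filter, Fintype.mem_piFinset, isFlag_succ_iff, Fin.snoc_castSucc,
      Fin.snoc_last, and_true]
    refine ⟨fun i => ?_, hflag, hG, hdesc⟩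
    refine Fin.lastCases ?_ (fun i => ?_) i
    · rw [Fin.snoc_last]
      exact hG
    · rw [Fin.snoc_castSucc]
      exact hmem i
  · intro f hf
    simp only [Finset.mem_filter] at hf
    obtain ⟨-, -, rfl⟩ := hf
    ext i : 1
    refine Fin.lastCases ?_ (fun i => ?_) i
    · rw [Fin.snoc_last]
    · rw [Fin.snoc_castSucc]
  · rintro ⟨F, f⟩ hf
    simp only [Finset.mem_sigma, Finset.mem_filter] at hf
    obtain ⟨-, -, -, rfl⟩ := hf
    simp only [Fin.snoc_castSucc]
  · intro f hf
    simp only [Finset.mem_filter] at hf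
    obtain ⟨-, -, rfl⟩ := hf
    rw [Fin.prod_univ_castSucc]
    rfl

lemma isRationalPolytope (hP : IsRationalPolytope P) {i : ℕ} {F : Set (Fin n → ℝ)}
    (hF : F ∈ D.layer i) : IsRationalPolytope F :=
  hP.face (D.face_of_mem_layer i F hF).1

lemma apex_mem_of_mem_layer {i : ℕ} {F : Set (Fin n → ℝ)} (hF : F ∈ D.layer i)
    (hs : ¬ IsSimplex F) : D.apex F ∈ F :=
  extremePoints_subset (D.apex_mem i F hF hs)

lemma eq_of_mem_layer {i j : ℕ} {F : Set (Fin n → ℝ)} (hi : F ∈ D.layer i)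
    (hj : F ∈ D.layer j) : i = j := by
  have h1 := (D.face_of_mem_layer i F hi).2
  have h2 := (D.face_of_mem_layer j F hj).2
  omega

lemma layer_eq_empty : D.layer (dim P + 1) = ∅ := by
  refine Finset.eq_empty_of_forall_notMem fun F hF => ?_
  have := (D.face_of_mem_layer _ F hF).2
  omega

open Classical in
-- Expand each nonsimplex by the pyramid formula and exchange the sums: the coefficient collected at
-- `G` is the weight recursion.
lemma sum_layer_eq (hP : IsRationalPolytope P) (k : ℕ) :
    ∑ F ∈ D.layer k, D.weight k F * latticeVolume F =
      ∑ F ∈ D.layer k with IsSimplex F, D.weight k F * latticeVolume F +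
        ∑ G ∈ D.layer (k + 1), D.weight (k + 1) G * latticeVolume G := by
  rw [← Finset.sum_filter_add_sum_filter_not (D.layer k) IsSimplex]
  congr 1
  have h1 : ∀ F ∈ (D.layer k).filter fun F => ¬ IsSimplex F, D.weight k F * latticeVolume F =
      ∑ G ∈ D.layer (k + 1), if D.Descends F G then
        D.weight k F * latticeHeight G (D.apex F) * latticeVolume G else 0 := by
    intro F hF
    obtain ⟨hF, hs⟩ := Finset.mem_filter.1 hF
    have hFP := D.isRationalPolytope hP hF
    rw [latticeVolume_eq_sum_facets hFP (dim_pos_of_not_isSimplex hFP hs)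
      (D.apex_mem_of_mem_layer hF hs) ((D.layer (k + 1)).filter fun G => D.Descends F G),
      Finset.mul_sum, Finset.sum_filter]
    · simp only [mul_assoc]
    · intro G
      rw [Finset.mem_filter]
      exact ⟨fun h => h.2.2, fun h => ⟨D.facet_mem_layer k F hF hs G h.1 h.2, hs, h⟩⟩
  rw [Finset.sum_congr rfl h1, Finset.sum_comm]
  refine Finset.sum_congr rfl fun G hG => ?_
  rw [D.weight_succ hG, Finset.sum_mul, ← Finset.sum_filter, Finset.filter_filter]
  refine Finset.sum_congr (Finset.filter_congr fun F _ => ?_) fun _ _ => rfl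
  exact ⟨fun h => h.2, fun h => ⟨h.1, h⟩⟩

open Classical in
lemma latticeVolume_eq_sum (hP : IsRationalPolytope P) :
    latticeVolume P = ∑ i ∈ Finset.range (dim P + 1), ∑ F ∈ D.layer i with IsSimplex F,
      D.weight i F * latticeVolume F := by
  have h : ∀ k, latticeVolume P = ∑ i ∈ Finset.range k, ∑ F ∈ D.layer i with IsSimplex F,
      D.weight i F * latticeVolume F + ∑ F ∈ D.layer k, D.weight k F * latticeVolume F := by
    intro k
    induction k with
    | zero => simp [D.layer_zero, D.weight_zero]
    | succ k ih => rw [Finset.sum_range_succ, add_assoc, ← D.sum_layer_eq hP, ← ih]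
  rw [h (dim P + 1), D.layer_eq_empty, Finset.sum_empty, add_zero]

end DescentSystem

/-! ### The processing of one face -/

open Classical in
-- Since `F` is not in the list, its weight stays fixed during the loop, and without duplicates
-- every facet is credited once. A weight left over from outside the next layer counts as `0`.
lemma foldl_pushFacet (F : Set (Fin n → ℝ)) (v : Fin n → ℝ) (l : List (Set (Fin n → ℝ)))
    (hl : l.Nodup) (hF : F ∉ l) (s : State n) :
    (l.foldl (State.pushFacet F v) s).current = s.current ∧
    (l.foldl (State.pushFacet F v) s).total = s.total ∧
    (l.foldl (State.pushFacet F v) s).next = s.next ∪ l.toFinset ∧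
    ∀ G, (l.foldl (State.pushFacet F v) s).weight G =
      if G ∈ l then (if G ∈ s.next then s.weight G else 0) + s.weight F * latticeHeight G v
      else s.weight G := by
  induction l generalizing s with
  | nil => simp
  | cons H l ih =>
    obtain ⟨hHl, hl⟩ := List.nodup_cons.1 hl
    obtain ⟨hFH, hFl⟩ := not_or.1 (mt List.mem_cons.2 hF)
    have hcur : (State.pushFacet F v s H).current = s.current := by
      by_cases h : H ∈ s.next <;> simp [State.pushFacet, State.insertNext, h]
    have htot : (State.pushFacet F v s H).total = s.total := by
      by_cases h : H ∈ s.next <;> simp [State.pushFacet, State.insertNext, h]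
    have hnext : (State.pushFacet F v s H).next = insert H s.next := by
      by_cases h : H ∈ s.next <;> simp [State.pushFacet, State.insertNext, h]
    have hw : (State.pushFacet F v s H).weight = Function.update s.weight H
        ((if H ∈ s.next then s.weight H else 0) + s.weight F * latticeHeight H v) := by
      by_cases h : H ∈ s.next <;> simp [State.pushFacet, State.insertNext, h, hFH]
    obtain ⟨h1, h2, h3, h4⟩ := ih hl hFl (State.pushFacet F v s H)
    rw [List.foldl_cons]
    refine ⟨h1.trans hcur, h2.trans htot, ?_, fun G => ?_⟩
    · rw [h3, hnext, List.toFinset_cons, Finset.insert_union, Finset.union_insert]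
    · rw [h4, hw, hnext, Function.update_of_ne hFH]
      by_cases hGH : G = H
      · subst hGH
        simp [hHl]
      · simp [hGH]

/-! ### Correctness of the algorithm -/

/-- A class of rational polytopes that is closed under the descent with the selection rule
`sel`, and in which this rule selects at least one point, and only points of the polytope. -/
structure IsDescentClass (sel : Set (Fin n → ℝ) → (Fin n → ℝ) → Prop)
    (C : Set (Set (Fin n → ℝ))) : Prop where
  isRationalPolytope : ∀ F ∈ C, IsRationalPolytope F
  mem_of_sel : ∀ F ∈ C, ¬ IsSimplex F → ∀ v, sel F v → v ∈ F
  exists_sel : ∀ F ∈ C, ¬ IsSimplex F → ∃ v, sel F v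
  facet_mem : ∀ F ∈ C, ¬ IsSimplex F → ∀ v, sel F v → ∀ G, IsFacet G F → v ∉ G → G ∈ C

/-- The current layer consists of members of `C` of dimension `m`, the next one of members of
dimension `m - 1`. -/
def State.IsLayered (C : Set (Set (Fin n → ℝ))) (m : ℕ) (s : State n) : Prop :=
  (∀ F ∈ s.current, F ∈ C ∧ dim F = m) ∧ ∀ G ∈ s.next, G ∈ C ∧ dim G + 1 = m

/-- The accumulated total together with the weighted volumes of the faces that are still to be
processed. -/
noncomputable def State.value (s : State n) : ℝ :=
  s.total + ∑ F ∈ s.current, s.weight F * latticeVolume F +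
    ∑ G ∈ s.next, s.weight G * latticeVolume G

variable {sel : Set (Fin n → ℝ) → (Fin n → ℝ) → Prop} {C : Set (Set (Fin n → ℝ))}

lemma IsFacet.ne {F G : Set (Fin n → ℝ)} (h : IsFacet G F) : G ≠ F := by
  rintro rfl
  have := h.2
  omega

/-- A simplex moves its summand into the total, a nonsimplex hands it to its facets by the pyramid
formula, and a layer change only relabels. The disjunction records the lexicographic decrease. -/
lemma IsDescentClass.step (hC : IsDescentClass sel C) {m : ℕ} {s t : State n}
    (hs : s.IsLayered C m) (hst : Step sel s t) :
    t.value = s.value ∧ ((t.IsLayered C m ∧ t.current.card < s.current.card) ∨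
      ∃ m', m = m' + 1 ∧ t.IsLayered C m') := by
  classical
  obtain ⟨hcur, hnext⟩ := hs
  cases hst with
  | simplex F hF hsimp =>
    refine ⟨?_, Or.inl ⟨⟨fun G hG => hcur G (Finset.mem_of_mem_erase hG), hnext⟩,
      Finset.card_erase_lt_of_mem hF⟩⟩
    simp only [State.value, State.addTotal, State.remove]
    rw [← Finset.add_sum_erase _ _ hF]
    ring
  | descend F hF hns v hv l hl hmem =>
    obtain ⟨hFC, hFm⟩ := hcur F hF
    have hFP := hC.isRationalPolytope F hFC
    have hFl : F ∉ l := fun h => ((hmem F).1 h).1.ne rfl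
    -- Facets have smaller dimension, so updating their weights leaves the current layer untouched.
    have hdisj : ∀ G ∈ s.current, G ∉ l := by
      intro G hG hGl
      have h1 := ((hmem G).1 hGl).1.2
      have h2 := (hcur G hG).2
      omega
    obtain ⟨h1, h2, h3, h4⟩ := foldl_pushFacet F v l hl hFl (s.remove F)
    set t := l.foldl (State.pushFacet F v) (s.remove F) with ht
    refine ⟨?_, Or.inl ⟨⟨fun G hG => ?_, fun G hG => ?_⟩, ?_⟩⟩
    · have hvol := latticeVolume_eq_sum_facets hFP (dim_pos_of_not_isSimplex hFP hns)
        (hC.mem_of_sel F hFC hns v hv) l.toFinset (fun G => by rw [List.mem_toFinset, hmem])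
      have hsum1 : ∑ G ∈ t.current, t.weight G * latticeVolume G =
          ∑ G ∈ s.current.erase F, s.weight G * latticeVolume G := by
        rw [h1]
        refine Finset.sum_congr rfl fun G hG => ?_
        rw [h4, if_neg (hdisj G (Finset.mem_of_mem_erase hG))]
        rfl
      have hsum2 : ∑ G ∈ t.next, t.weight G * latticeVolume G =
          ∑ G ∈ s.next, s.weight G * latticeVolume G + s.weight F * latticeVolume F := by
        rw [h3, hvol, Finset.mul_sum]
        have hterm : ∀ G ∈ (s.remove F).next ∪ l.toFinset, t.weight G * latticeVolume G =
            (if G ∈ s.next then s.weight G * latticeVolume G else 0) +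
              if G ∈ l.toFinset then s.weight F * (latticeHeight G v * latticeVolume G)
              else 0 := by
          intro G hG
          rw [h4]
          simp only [State.remove, Finset.mem_union, List.mem_toFinset] at hG ⊢
          by_cases hGl : G ∈ l
          · by_cases hGn : G ∈ s.next
            · simp only [hGl, hGn, if_true]; ring
            · simp only [hGl, hGn, if_true, if_false]; ring
          · simp [hGl, hG.resolve_right hGl]
        rw [Finset.sum_congr rfl hterm, Finset.sum_add_distrib, Finset.sum_ite_mem,
          Finset.sum_ite_mem]
        congr 1
        · have : ((s.remove F).next ∪ l.toFinset) ∩ s.next = s.next :=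
            Finset.inter_eq_right.2 (Finset.subset_union_left (s₁ := s.next))
          rw [this]
        · rw [Finset.inter_eq_right.2 Finset.subset_union_right]
      rw [State.value, State.value, hsum1, hsum2, h2, ← Finset.add_sum_erase _ _ hF]
      simp only [State.remove]
      ring
    · rw [h1] at hG
      exact hcur G (Finset.mem_of_mem_erase hG)
    · rw [h3, Finset.mem_union, List.mem_toFinset, hmem] at hG
      rcases hG with hG | ⟨hG, hvG⟩
      · exact hnext G hG
      · exact ⟨hC.facet_mem F hFC hns v hv G hG hvG, hG.2.trans hFm⟩
    · rw [h1]
      exact Finset.card_erase_lt_of_mem hF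
  | nextLayer hc hn =>
    refine ⟨by simp [State.value, hc], Or.inr ?_⟩
    obtain ⟨G, hG⟩ := Finset.nonempty_iff_ne_empty.2 hn
    -- The next layer is nonempty, so any of its members supplies the new dimension and shows `m` to
    -- be positive.
    refine ⟨dim G, (hnext G hG).2.symm, fun G' hG' => ⟨(hnext G' hG').1, ?_⟩, by simp⟩
    have h1 := (hnext G hG).2
    have h2 := (hnext G' hG').2
    omega

/-- Nested induction on dimension and number of unprocessed faces; the size of the next layer needs
no bound, because a layer change lowers the dimension. -/
lemma IsDescentClass.acc (hC : IsDescentClass sel C) (m : ℕ) :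
    ∀ s : State n, s.IsLayered C m → Acc (fun t s => Step sel s t) s := by
  induction m using Nat.strong_induction_on with
  | _ m ihm =>
    intro s hs
    induction hk : s.current.card using Nat.strong_induction_on generalizing s with
    | _ k ihk =>
      refine ⟨s, fun t hst => ?_⟩
      obtain ⟨-, ⟨ht, hcard⟩ | ⟨m', rfl, ht⟩⟩ := hC.step hs hst
      · exact ihk _ (hk ▸ hcard) t ht rfl
      · exact ihm m' m'.lt_succ_self t ht

lemma State.isLayered_init {P : Set (Fin n → ℝ)} (hP : P ∈ C) :
    (State.init P).IsLayered C (dim P) := by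
  refine ⟨fun F hF => ?_, fun G hG => by simp [State.init] at hG⟩
  have : F = P := by simpa [State.init] using hF
  rw [this]
  exact ⟨hP, rfl⟩

lemma State.value_init (P : Set (Fin n → ℝ)) : (State.init P).value = latticeVolume P := by
  simp [State.value, State.init]

lemma IsDescentClass.reachable (hC : IsDescentClass sel C) {P : Set (Fin n → ℝ)} (hP : P ∈ C)
    {s : State n} (hs : Reachable sel P s) :
    s.value = latticeVolume P ∧ ∃ m, s.IsLayered C m := by
  induction hs with
  | refl => exact ⟨State.value_init P, _, State.isLayered_init hP⟩
  | tail _ hst ih =>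
    obtain ⟨hval, m, hm⟩ := ih
    obtain ⟨h, ht⟩ := hC.step hm hst
    refine ⟨h.trans hval, ?_⟩
    rcases ht with ⟨ht, -⟩ | ⟨m', -, ht⟩
    · exact ⟨_, ht⟩
    · exact ⟨_, ht⟩

lemma IsDescentClass.exists_step (hC : IsDescentClass sel C) {m : ℕ} {s : State n}
    (hs : s.IsLayered C m) (hfin : ¬ s.Finished) : ∃ t, Step sel s t := by
  by_cases hc : s.current = ∅
  · exact ⟨_, Step.nextLayer s hc fun hn => hfin ⟨hc, hn⟩⟩
  · obtain ⟨F, hF⟩ := Finset.nonempty_iff_ne_empty.2 hc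
    by_cases hsimp : IsSimplex F
    · exact ⟨_, Step.simplex s F hF hsimp⟩
    · obtain ⟨hFC, -⟩ := hs.1 F hF
      obtain ⟨v, hv⟩ := hC.exists_sel F hFC hsimp
      have hfinite : {G | IsFacet G F ∧ v ∉ G}.Finite :=
        (hC.isRationalPolytope F hFC).finite_facets.subset fun G hG => hG.1
      exact ⟨_, Step.descend s F hF hsimp v hv hfinite.toFinset.toList
        (Finset.nodup_toList _) fun G => by simp⟩

theorem IsDescentClass.computes (hC : IsDescentClass sel C) {P : Set (Fin n → ℝ)}
    (hP : P ∈ C) : Computes sel P (latticeVolume P) := by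
  refine ⟨?_, fun s hs hfin => ?_, fun s hs hfin => ?_⟩
  · rintro ⟨run, h0, hrun⟩
    have hacc : Acc (fun t s => Step sel s t) (run 0) := by
      rw [h0]
      exact hC.acc _ _ (State.isLayered_init hP)
    have hno : ∀ s, Acc (fun t s => Step sel s t) s → ∀ k, run k ≠ s := by
      intro s hs
      induction hs with
      | intro s _ ih => exact fun k hk => ih (run (k + 1)) (hk ▸ hrun k) (k + 1) rfl
    exact hno _ hacc 0 rfl
  · obtain ⟨-, m, hm⟩ := hC.reachable hP hs
    exact hC.exists_step hm hfin
  · have h := (hC.reachable hP hs).1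
    rw [State.value, hfin.1, hfin.2] at h
    simpa using h

lemma isDescentClass_isRationalPolytope :
    IsDescentClass (fun F v => v ∈ F.extremePoints ℝ)
      {F : Set (Fin n → ℝ) | IsRationalPolytope F} where
  isRationalPolytope _ hF := hF
  mem_of_sel _ _ _ _ hv := extremePoints_subset hv
  exists_sel _ hF _ :=
    IsCompact.extremePoints_nonempty (IsRationalPolytope.isCompact hF)
      (IsRationalPolytope.nonempty hF)
  facet_mem _ hF _ _ _ _ hG _ := IsRationalPolytope.face hF hG.1

/-! ### Runs that follow a descent system -/

namespace DescentSystem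

variable {P : Set (Fin n → ℝ)} (D : DescentSystem P)

lemma isDescentClass (hP : IsRationalPolytope P) :
    IsDescentClass (fun F v => v = D.apex F) {F | ∃ i, F ∈ D.layer i} where
  isRationalPolytope := fun _ ⟨_, hF⟩ => D.isRationalPolytope hP hF
  mem_of_sel := by
    rintro F ⟨i, hF⟩ hs _ rfl
    exact D.apex_mem_of_mem_layer hF hs
  exists_sel F _ _ := ⟨D.apex F, rfl⟩
  facet_mem := by
    rintro F ⟨i, hF⟩ hs _ rfl G hG hvG
    exact ⟨i + 1, D.facet_mem_layer i F hF hs G hG hvG⟩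

lemma mem_layer_zero : P ∈ D.layer 0 := by
  rw [D.layer_zero]
  exact Finset.mem_singleton_self P

open Classical in
/-- The state `s` occurs while the `k`-th layer is processed: all weights in the layers up to the
`k`-th one are final, and the weights in the next layer are the contributions of the faces that
have been processed. -/
structure IsProcessing (k : ℕ) (s : State n) : Prop where
  current_subset : s.current ⊆ D.layer k
  weight_eq : ∀ i ≤ k, ∀ F ∈ D.layer i, s.weight F = D.weight i F
  mem_next : ∀ G, G ∈ s.next ↔ ∃ F ∈ D.layer k \ s.current, D.Descends F G
  weight_next : ∀ G, (if G ∈ s.next then s.weight G else 0) =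
    ∑ F ∈ D.layer k \ s.current with D.Descends F G,
      D.weight k F * latticeHeight G (D.apex F)

lemma isProcessing_init : D.IsProcessing 0 (State.init P) where
  current_subset := by simp [State.init, D.layer_zero]
  weight_eq := by
    intro i hi F hF
    obtain rfl := Nat.le_zero.1 hi
    rw [D.layer_zero, Finset.mem_singleton] at hF
    subst hF
    simp [State.init, D.weight_zero]
  mem_next G := by simp [State.init, D.layer_zero]
  weight_next G := by simp [State.init, D.layer_zero]

/-- The processed faces are `D.layer k \ s.current`. Processing `F` moves it there and adds exactly
its summand of the weight recursion, so the recursion is complete when the layer is exhausted. -/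
lemma IsProcessing.step {D : DescentSystem P} {k : ℕ} {s t : State n} (hs : D.IsProcessing k s)
    (hst : Step (fun F v => v = D.apex F) s t) : ∃ k', D.IsProcessing k' t := by
  classical
  have herase : ∀ F ∈ s.current,
      D.layer k \ s.current.erase F = insert F (D.layer k \ s.current) := fun F hF =>
    Finset.sdiff_erase (hs.current_subset hF)
  have hnotMem : ∀ F ∈ s.current, F ∉ D.layer k \ s.current := fun F hF h =>
    (Finset.mem_sdiff.1 h).2 hF
  cases hst with
  | simplex F hF hsimp =>
    have hdesc : ∀ G, ¬ D.Descends F G := fun G h => h.1 hsimp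
    refine ⟨k, (Finset.erase_subset _ _).trans hs.current_subset, hs.weight_eq, fun G => ?_,
      fun G => ?_⟩
    · simp only [State.addTotal, State.remove]
      rw [herase F hF, hs.mem_next]
      simp [hdesc]
    · have e : D.layer k \ ((s.remove F).addTotal (s.weight F * latticeVolume F)).current =
          insert F (D.layer k \ s.current) := herase F hF
      rw [e, Finset.filter_insert, if_neg (hdesc G)]
      exact hs.weight_next G
  | descend F hF hns v hv l hl hmem =>
    subst hv
    have hFk := hs.current_subset hF
    have hFl : F ∉ l := fun h => ((hmem F).1 h).1.ne rfl
    have hdesc : ∀ G, G ∈ l ↔ D.Descends F G := fun G => by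
      rw [hmem, Descends]
      exact (and_iff_right hns).symm
    obtain ⟨h1, -, h3, h4⟩ := foldl_pushFacet F (D.apex F) l hl hFl (s.remove F)
    refine ⟨k, ?_, fun i hi H hH => ?_, fun G => ?_, fun G => ?_⟩
    · rw [h1]
      exact (Finset.erase_subset _ _).trans hs.current_subset
    · rw [h4, if_neg, ← hs.weight_eq i hi H hH]
      · rfl
      -- An updated face lies in layer `k + 1`, and the dimension determines the layer, so final
      -- weights are never overwritten.
      · intro hHl
        obtain ⟨hH1, hH2⟩ := (hmem H).1 hHl
        have := D.eq_of_mem_layer hH (D.facet_mem_layer k F hFk hns H hH1 hH2)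
        omega
    · rw [h1, h3]
      simp only [State.remove]
      rw [herase F hF, Finset.mem_union, List.mem_toFinset, hdesc, hs.mem_next,
        Finset.exists_mem_insert, or_comm]
    · have e : D.layer k \ (s.remove F).current = insert F (D.layer k \ s.current) :=
        herase F hF
      rw [h1, h3, h4, e, Finset.filter_insert]
      by_cases hG : G ∈ l
      · rw [if_pos ((hdesc G).1 hG), Finset.sum_insert (fun h => hnotMem F hF
          (Finset.mem_filter.1 h).1), ← hs.weight_next, if_pos hG, if_pos (by simp [hG]),
          ← hs.weight_eq k le_rfl F hFk, add_comm]
        rfl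
      · rw [if_neg (mt (hdesc G).2 hG), ← hs.weight_next, if_neg hG]
        simp [hG, State.remove]
  | nextLayer hc hn =>
    have hnext : s.next = D.layer (k + 1) := by
      ext G
      rw [hs.mem_next, hc, Finset.sdiff_empty]
      constructor
      · rintro ⟨F, hF, h⟩
        exact D.facet_mem_layer k F hF h.1 G h.2.1 h.2.2
      · exact D.exists_of_mem_layer k G
    refine ⟨k + 1, hnext.subset, fun i hi F hF => ?_, fun G => ?_, fun G => ?_⟩
    · rcases Nat.le_succ_iff.1 hi with hi | rfl
      · exact hs.weight_eq i hi F hF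
      · have h := hs.weight_next F
        rw [hc, Finset.sdiff_empty, ← D.weight_succ hF, if_pos (hnext ▸ hF)] at h
        exact h
    · simp [hnext]
    · simp [hnext]

lemma exists_isProcessing {s : State n} (hs : Reachable (fun F v => v = D.apex F) P s) :
    ∃ k, D.IsProcessing k s := by
  induction hs with
  | refl => exact ⟨0, D.isProcessing_init⟩
  | tail _ hst ih =>
    obtain ⟨k, hk⟩ := ih
    exact hk.step hst

lemma weight_eq_of_finished {s : State n} (hs : Reachable (fun F v => v = D.apex F) P s)
    (hfin : s.Finished) (i : ℕ) (F : Set (Fin n → ℝ)) (hF : F ∈ D.layer i) :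
    s.weight F = D.weight i F := by
  obtain ⟨k, hk⟩ := D.exists_isProcessing hs
  -- With nothing left to process and no next face, layer `k + 1` is empty; each later layer needs
  -- parents in the preceding one, so it is empty too.
  have hempty : ∀ j, D.layer (k + 1 + j) = ∅ := by
    intro j
    induction j with
    | zero =>
      refine Finset.eq_empty_of_forall_notMem fun G hG => ?_
      have : G ∈ s.next := by
        rw [hk.mem_next, hfin.1, Finset.sdiff_empty]
        exact D.exists_of_mem_layer k G hG
      rw [hfin.2] at this
      exact Finset.notMem_empty G this
    | succ j ih =>
      refine Finset.eq_empty_of_forall_notMem fun G hG => ?_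
      obtain ⟨F, hF, -⟩ := D.exists_of_mem_layer (k + 1 + j) G hG
      rw [ih] at hF
      exact Finset.notMem_empty F hF
  refine hk.weight_eq i ?_ F hF
  by_contra hi
  obtain ⟨j, rfl⟩ := Nat.exists_eq_add_of_le (show k + 1 ≤ i by omega)
  rw [hempty] at hF
  exact Finset.notMem_empty F hF

end DescentSystem

end Descent

open Descent Classical in
theorem mainTheorem2 {n : ℕ} (P : Set (Fin n → ℝ)) (hP : IsRationalPolytope P) :
    (∀ D : DescentSystem P,
      (latticeVolume P = ∑ i ∈ Finset.range (dim P + 1), ∑ F ∈ D.layer i with IsSimplex F,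
        D.weight i F * latticeVolume F) ∧
      Computes (fun F v => v = D.apex F) P (latticeVolume P) ∧
      (∀ s, Reachable (fun F v => v = D.apex F) P s → s.Finished →
        ∀ i, ∀ F ∈ D.layer i, s.weight F = D.weight i F)) ∧
    Computes (fun F v => v ∈ F.extremePoints ℝ) P (latticeVolume P) := by
  refine ⟨fun D => ⟨D.latticeVolume_eq_sum hP, ?_, fun s hs hfin => ?_⟩, ?_⟩
  · exact (D.isDescentClass hP).computes ⟨0, D.mem_layer_zero⟩
  · exact D.weight_eq_of_finished hs hfin
  · exact isDescentClass_isRationalPolytope.computes hP
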